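/- A bipartite graph $G=(U,W,E)$ (finite, simple, vertex set the disjoint union $U\cup W$, every edge joining $U$ to $W$) is \emph{convex} if the vertices of $W$ can be ordered so that for every $u\in U$ the neighbours of $u$ are consecutive in this ordering. A set $D$ of vertices is a \emph{connected dominating set} of $G$ if the induced subgraph $G[D]$ is connected (in particular $D\neq\emptyset$) and every vertex of $G$ lies in $D$ or has a neighbour in $D$; it is \emph{minimal} if no proper subset of $D$ is a connected dominating set of $G$. \textbf{Theorem.} (1) There is a constant $C$ such that every convex bipartite graph on $n$ vertices has at most $C\cdot 1.7254^{\,n}$ minimal connected dominating sets. (2) There are an algorithm and a constant $C$ such that, for every convex bipartite graph $G=(U,W,E)$ with vertex set $\{0,\dots,n-1\}$, the algorithm, given the set $U$ and the adjacency matrix of $G$ (but no ordering of $W$), outputs within $C\cdot 1.7254^{\,n}$ steps a list, without repetitions, of exactly the minimal connected dominating sets of $G$. Here an algorithm is a program in a first-order functional language over binary trees with general recursion (pure Lisp with $\mathrm{nil}$ as its only atom): a finite list of functions whose bodies are built from variables, $\mathrm{nil}$, $\mathrm{cons}$, $\mathrm{head}$, $\mathrm{tail}$, a test for $\mathrm{nil}$,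 local bindings and calls of the functions. Each evaluation of one of these constructs counts as one step, which takes constant time on a random access machine. Vertex sets are given as characteristic vectors and the adjacency matrix as the list of its rows. -/

import Mathlib

/-! ### Convex bipartite graphs -/

/-- `G = (U, W, E)` is a convex bipartite graph: `U` and `W` partition the vertex set, every edge
joins a vertex of `U` to a vertex of `W`, and the vertices of `W` can be ordered as
`σ 0, σ 1, …, σ (|W| - 1)` in such a way that the neighbours of each `u ∈ U` are consecutive. -/
def IsConvexBipartite {V : Type*} (G : SimpleGraph V) (U W : Finset V) : Prop :=
  (∀ v : V, v ∈ U ∨ v ∈ W) ∧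
  G.IsBipartiteWith (U : Set V) (W : Set V) ∧
  ∃ σ : Fin W.card ≃ {w : V // w ∈ W},
    ∀ u ∈ U, Set.OrdConnected {i : Fin W.card | G.Adj u (σ i : V)}

/-! ### Minimal connected dominating sets -/

/-- `D` induces a connected (in particular nonempty) subgraph, and each vertex of `G` lies in `D`
or has a neighbour in `D`. -/
def IsConnectedDominatingSet {V : Type*} (G : SimpleGraph V) (D : Finset V) : Prop :=
  (G.induce (D : Set V)).Connected ∧ ∀ v : V, v ∈ D ∨ ∃ w ∈ D, G.Adj v w

/-- No proper subset of the connected dominating set `D` is a connected dominating set. -/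
def IsMinimalConnectedDominatingSet {V : Type*} (G : SimpleGraph V) (D : Finset V) : Prop :=
  Minimal (IsConnectedDominatingSet G) D

/-! ### Algorithms and their running time

Algorithms are programs of a first-order functional language over binary trees (pure Lisp with
`nil` as its only atom).  The running time is the number of evaluation steps.  Trees are immutable
and are passed by reference, so each step takes constant time on a random access machine: it
reads or creates one cell, tests one cell for being `nil`, or manipulates one stack frame. -/

namespace Lisp

/-- The data: binary trees. -/
inductive Data : Type
  | nil : Data
  | cons : Data → Data → Data

/-- The first component; that of `nil` is `nil`. -/
def Data.head : Data → Data
  | .nil => .nil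
  | .cons a _ => a

/-- The second component; that of `nil` is `nil`. -/
def Data.tail : Data → Data
  | .nil => .nil
  | .cons _ b => b

/-- The terms.  Variables are de Bruijn indices; `bind s t` evaluates `s` and makes its value the
variable `0` of `t`; `ite c s t` is `t` if `c` evaluates to `nil` and `s` otherwise; `call f t`
applies the `f`-th function of the program to the value of `t`. -/
inductive Term : Type
  | var : ℕ → Term
  | nil : Term
  | cons : Term → Term → Term
  | head : Term → Term
  | tail : Term → Term
  | ite : Term → Term → Term → Term
  | bind : Term → Term → Term
  | call : ℕ → Term → Term

/-- A program is a finite list of (mutually recursive) functions of one argument, each given by its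
body, in which the variable `0` is the argument.  The function number `0` is the main function. -/
abbrev Program : Type := List Term

/-- `Eval P e t d k`: in the program `P`, when the variables `0, 1, …` have the values listed in
`e`, the evaluation of the term `t` terminates with the value `d` after exactly `k` steps. -/
inductive Eval (P : Program) : List Data → Term → Data → ℕ → Prop
  | var {e : List Data} {i : ℕ} {a : Data} (ha : e[i]? = some a) : Eval P e (.var i) a 1
  | nil {e : List Data} : Eval P e .nil .nil 1
  | cons {e : List Data} {s t : Term} {a b : Data} {k l : ℕ}
      (hs : Eval P e s a k) (ht : Eval P e t b l) : Eval P e (.cons s t) (.cons a b) (k + l + 1)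
  | head {e : List Data} {t : Term} {a : Data} {k : ℕ}
      (ht : Eval P e t a k) : Eval P e (.head t) a.head (k + 1)
  | tail {e : List Data} {t : Term} {a : Data} {k : ℕ}
      (ht : Eval P e t a k) : Eval P e (.tail t) a.tail (k + 1)
  | ite_nil {e : List Data} {c s t : Term} {a : Data} {k l : ℕ}
      (hc : Eval P e c .nil k) (ht : Eval P e t a l) : Eval P e (.ite c s t) a (k + l + 1)
  | ite_cons {e : List Data} {c s t : Term} {a b d : Data} {k l : ℕ}
      (hc : Eval P e c (.cons b d) k) (hs : Eval P e s a l) : Eval P e (.ite c s t) a (k + l + 1)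
  | bind {e : List Data} {s t : Term} {a b : Data} {k l : ℕ}
      (hs : Eval P e s a k) (ht : Eval P (a :: e) t b l) : Eval P e (.bind s t) b (k + l + 1)
  | call {e : List Data} {f : ℕ} {body t : Term} {a b : Data} {k l : ℕ}
      (hf : P[f]? = some body) (ht : Eval P e t a k) (hb : Eval P [a] body b l) :
      Eval P e (.call f t) b (k + l + 1)

/-- On the input `x` the program `P` terminates with the output `y` after exactly `k` steps. -/
def Program.Outputs (P : Program) (x y : Data) (k : ℕ) : Prop :=
  Eval P [x] (.call 0 (.var 0)) y k

/-- The tree that represents a list of trees. -/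
def Data.ofList : List Data → Data
  | [] => .nil
  | a :: l => .cons a (Data.ofList l)

open Classical in
/-- The tree that represents a truth value: `nil` for false, `cons nil nil` for true. -/
noncomputable def Data.ofProp (p : Prop) : Data :=
  if p then .cons .nil .nil else .nil

/-- A set of vertices is represented by its characteristic vector, a list of length `n`. -/
noncomputable def Data.ofVertexSet {n : ℕ} (S : Finset (Fin n)) : Data :=
  Data.ofList (List.ofFn fun v : Fin n => Data.ofProp (v ∈ S))

/-- A bipartite graph with vertex set `{0, …, n - 1}` and first colour class `U` is represented by
the pair of the characteristic vector of `U` and the adjacency matrix (the list of its rows).  No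
convex ordering of the second colour class is supplied. -/
noncomputable def Data.ofGraph {n : ℕ} (G : SimpleGraph (Fin n)) (U : Finset (Fin n)) : Data :=
  .cons (Data.ofVertexSet U)
    (Data.ofList (List.ofFn fun v : Fin n =>
      Data.ofList (List.ofFn fun w : Fin n => Data.ofProp (G.Adj v w))))

/-- A list of sets of vertices, as a tree. -/
noncomputable def Data.ofFamily {n : ℕ} (L : List (Finset (Fin n))) : Data :=
  Data.ofList (L.map Data.ofVertexSet)

end Lisp

/-! Let S be the smaller and A the larger colour class. A minimal connected dominating set D is
determined by B = D ∩ S and T = D ∩ A, and there are only 2^|S| choices for B. Fix B such that B ∪ A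
is a connected dominating set. Call e a hyperedge if e is A itself or N(x) ∩ N(y) with x, y ∈ S, and
(B ∪ A) \ e is not a connected dominating set. Supersets of connected dominating sets are connected
dominating sets, so T hits every hyperedge. Conversely, convexity shows that every T ⊆ A for which B
∪ T fails misses some hyperedge: the failure is visible at a gap between two consecutive chosen
vertices of W (`rich_left`, `rich_right`). Hence minimality of D makes T a minimal transversal of
the hyperedges (`isMinimalTransversal_of_isMinimal`).

Convexity is used a second time. Among the traces of candidates on any set R there is one, e, on
which the others cut out a chain (`hasNested_right`, `hasNested_left`). A minimal transversal meets
such an e in exactly one vertex (`IsMinimalTransversal.exists_residual`). Branching over the s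
vertices of e therefore removes all s of them from the ground set, so the number f(r) of leaves on r
points satisfies f(r) ≤ s · f(r - s). Since s ≤ 1.45^s, this gives 1.45^|A| leaves. With |S| ≤ |A|
the product 2^|S| · 1.45^|A| is at most 1.703^n, and the gap up to 1.7254 absorbs all polynomial
factors.

The order of W occurs only in the proof that a nested e exists; the program finds e by testing all
hyperedges. Correctness and cost of each function are proved together. The counting bound (1) is a
consequence of (2): k steps cannot build a list whose length exceeds k plus the height of the input.
-/

/-! ### Connected dominating sets and reachability -/

section Reach

variable {V : Type*} {G : SimpleGraph V} {D D' : Finset V}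

/-- `w` can be reached from `v` along a walk all of whose vertices but the last lie in `D`. -/
def ReachThrough (G : SimpleGraph V) (D : Finset V) (v w : V) : Prop :=
  Relation.ReflTransGen (fun a b => a ∈ D ∧ G.Adj a b) v w

theorem ReachThrough.mono (h : D ⊆ D') {v w : V} (hr : ReachThrough G D v w) :
    ReachThrough G D' v w :=
  Relation.ReflTransGen.mono (fun _ _ hab => ⟨h hab.1, hab.2⟩) _ _ hr

theorem reachThrough_of_reachable {v w : (D : Set V)} (h : (G.induce (D : Set V)).Reachable v w) :
    ReachThrough G D v w := by
  obtain ⟨p⟩ := h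
  induction p with
  | nil => exact Relation.ReflTransGen.refl
  | @cons a b c hab _ ih => exact Relation.ReflTransGen.head ⟨a.2, hab⟩ ih

theorem reachable_of_reachThrough {v w : V} (hv : v ∈ D) (h : ReachThrough G D v w)
    (hw : w ∈ D) : (G.induce (D : Set V)).Reachable ⟨v, hv⟩ ⟨w, hw⟩ := by
  induction h with
  | refl => exact SimpleGraph.Reachable.refl _
  | @tail b c _ hbc ih =>
    refine (ih hbc.1).trans (SimpleGraph.Adj.reachable ?_)
    exact hbc.2

theorem IsConnectedDominatingSet.reachThrough (h : IsConnectedDominatingSet G D) {v : V}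
    (hv : v ∈ D) (w : V) : ReachThrough G D v w := by
  rcases h.2 w with hw | ⟨x, hx, hwx⟩
  · exact reachThrough_of_reachable (h.1.preconnected ⟨v, hv⟩ ⟨w, hw⟩)
  · exact Relation.ReflTransGen.tail
      (reachThrough_of_reachable (h.1.preconnected ⟨v, hv⟩ ⟨x, hx⟩)) ⟨hx, hwx.symm⟩

theorem isConnectedDominatingSet_of_reachThrough {v : V} (hv : v ∈ D)
    (h : ∀ w, ReachThrough G D v w) : IsConnectedDominatingSet G D := by
  refine ⟨?_, fun w => ?_⟩
  · have : Nonempty (D : Set V) := ⟨⟨v, hv⟩⟩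
    refine ⟨fun a b => ?_⟩
    exact (reachable_of_reachThrough hv (h a) a.2).symm.trans
      (reachable_of_reachThrough hv (h b) b.2)
  · rcases Relation.ReflTransGen.cases_tail (h w) with rfl | ⟨c, _, hc⟩
    · exact Or.inl hv
    · exact Or.inr ⟨c, hc.1, hc.2.symm⟩

theorem IsConnectedDominatingSet.nonempty (h : IsConnectedDominatingSet G D) : D.Nonempty := by
  obtain ⟨⟨v, hv⟩⟩ := h.1.nonempty
  exact ⟨v, hv⟩

/-- Only the last vertex of a walk may lie outside D, so reaching the vertices of D expresses
connectedness and reaching the others expresses domination. Both conditions become one reachability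
condition, which is monotone in D. -/
theorem isConnectedDominatingSet_iff :
    IsConnectedDominatingSet G D ↔ ∃ v ∈ D, ∀ w, ReachThrough G D v w :=
  ⟨fun h => h.nonempty.imp fun _ hv => ⟨hv, h.reachThrough hv⟩,
    fun ⟨_, hv, h⟩ => isConnectedDominatingSet_of_reachThrough hv h⟩

theorem IsConnectedDominatingSet.mono (h : IsConnectedDominatingSet G D) (hD : D ⊆ D') :
    IsConnectedDominatingSet G D' := by
  obtain ⟨v, hv⟩ := h.nonempty
  exact isConnectedDominatingSet_of_reachThrough (hD hv) fun w => (h.reachThrough hv w).mono hD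

/-- A walk inside D that starts in K never leaves K. This is how the sets (B ∪ A) \ e are shown to
fail. -/
theorem not_isConnectedDominatingSet_of_cut (K : V → Prop)
    (hK : ∀ a ∈ D, ∀ b ∈ D, G.Adj a b → K a → K b) {a b : V} (ha : a ∈ D) (hb : b ∈ D)
    (hKa : K a) (hKb : ¬ K b) : ¬ IsConnectedDominatingSet G D := fun h => by
  have key : ∀ w, ReachThrough G D a w → w ∈ D → K w := by
    intro w hw
    induction hw with
    | refl => exact fun _ => hKa
    | @tail b c _ hbc ih => exact fun hc => hK b hbc.1 c hc hbc.2 (ih hbc.1)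
  exact hKb (key b (h.reachThrough ha b) hb)

/-- By monotonicity, a smaller connected dominating set may be enlarged until just one vertex is
missing. So n deletions suffice to test minimality. -/
theorem isMinimalConnectedDominatingSet_iff [DecidableEq V] :
    IsMinimalConnectedDominatingSet G D ↔ IsConnectedDominatingSet G D ∧
      ∀ v ∈ D, ¬ IsConnectedDominatingSet G (D.erase v) := by
  constructor
  · intro h
    refine ⟨h.prop, fun v hv hc => ?_⟩
    exact Finset.notMem_erase v D (h.le_of_le hc (Finset.erase_subset v D) hv)
  · rintro ⟨h1, h2⟩
    refine ⟨h1, fun E hE hED v hv => ?_⟩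
    by_contra hvE
    exact h2 v hv (hE.mono fun x hx => Finset.mem_erase.2 ⟨fun h => hvE (h ▸ hx), hED hx⟩)

end Reach

/-! ### Bipartitions and convex orders -/

section Sides

variable {V : Type*} {G : SimpleGraph V}

/-- The vertex set splits into the independent sets `S` and `A`. -/
structure Sides (G : SimpleGraph V) (S A : Finset V) : Prop where
  cover : ∀ v, v ∈ S ∨ v ∈ A
  disj : Disjoint S A
  adj_left : ∀ {x y}, G.Adj x y → x ∈ S → y ∈ A
  adj_right : ∀ {x y}, G.Adj x y → x ∈ A → y ∈ S

theorem Sides.symm {S A : Finset V} (h : Sides G S A) : Sides G A S :=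
  ⟨fun v => (h.cover v).symm, h.disj.symm, h.adj_right, h.adj_left⟩

/-- `pos` orders `W` in such a way that neighbourhoods of vertices outside `W` are intervals. -/
structure ConvexOrder (G : SimpleGraph V) (W : Finset V) (pos : V → ℕ) : Prop where
  inj : Set.InjOn pos W
  conv : ∀ {u a b c}, G.Adj u a → G.Adj u c → a ∈ W → b ∈ W → c ∈ W →
    pos a ≤ pos b → pos b ≤ pos c → G.Adj u b

theorem IsConvexBipartite.sides {U W : Finset V} (h : IsConvexBipartite G U W) : Sides G U W := by
  obtain ⟨h1, h2, _⟩ := h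
  refine ⟨h1, by simpa using h2.disjoint, fun {x y} hxy hx => ?_, fun {x y} hxy hx => ?_⟩
  · exact_mod_cast h2.mem_of_mem_adj (by exact_mod_cast hx) hxy
  · exact_mod_cast h2.symm.mem_of_mem_adj (by exact_mod_cast hx) hxy

theorem IsConvexBipartite.exists_convexOrder {U W : Finset V} (h : IsConvexBipartite G U W) :
    ∃ pos, ConvexOrder G W pos := by
  classical
  have hs := h.sides
  obtain ⟨_, _, σ, hσ⟩ := h
  -- The value 0 outside W is harmless, because both fields of `ConvexOrder` compare positions in W
  -- only.
  refine ⟨fun v => if hv : v ∈ W then (σ.symm ⟨v, hv⟩ : ℕ) else 0, ?_, ?_⟩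
  · intro a ha b hb hab
    have ha' : a ∈ W := ha
    have hb' : b ∈ W := hb
    simp only [ha', hb', dif_pos] at hab
    have := σ.symm.injective (Fin.ext hab)
    simpa using this
  · intro u a b c hua huc ha hb hc hab hbc
    simp only [ha, hb, hc, dif_pos] at hab hbc
    have hu : u ∈ U := hs.adj_right hua.symm ha
    have := (hσ u hu).out (x := σ.symm ⟨a, ha⟩) (y := σ.symm ⟨c, hc⟩) (by simpa using hua)
      (by simpa using huc) (show σ.symm ⟨b, hb⟩ ∈ _ from ⟨hab, hbc⟩)
    simpa using this

/-- Take a pair separated by K whose positions are as close as possible. A point strictly between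
the two would form a closer separated pair with one of them. -/
theorem exists_consecutive (P : Finset V) (pos : V → ℕ) (hinj : Set.InjOn pos P) (K : V → Prop)
    {a b : V} (ha : a ∈ P) (hb : b ∈ P) (hKa : K a) (hKb : ¬ K b) :
    ∃ p ∈ P, ∃ q ∈ P, pos p < pos q ∧ ¬ (K p ↔ K q) ∧
      ∀ r ∈ P, pos r ≤ pos p ∨ pos q ≤ pos r := by
  classical
  have hne : ((P ×ˢ P).filter fun x : V × V => pos x.1 < pos x.2 ∧ ¬ (K x.1 ↔ K x.2)).Nonempty := by
    have hab : pos a ≠ pos b := fun h => hKb (hinj ha hb h ▸ hKa)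
    rcases lt_or_gt_of_ne hab with h | h
    · exact ⟨(a, b), by simp [ha, hb, h, hKa, hKb]⟩
    · exact ⟨(b, a), by simp [ha, hb, h, hKa, hKb]⟩
  obtain ⟨⟨p, q⟩, hpq, hmin⟩ := Finset.exists_min_image _ (fun x : V × V => pos x.2 - pos x.1) hne
  simp only [Finset.mem_filter, Finset.mem_product, Prod.forall, and_imp] at hpq hmin
  obtain ⟨⟨hp, hq⟩, hlt, hK⟩ := hpq
  refine ⟨p, hp, q, hq, hlt, hK, fun r hr => ?_⟩
  by_contra! hcon
  by_cases hKr : K p ↔ K r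
  · have := hmin r q hr hq hcon.2 (by rwa [← hKr])
    omega
  · have := hmin p r hp hr hcon.1 hKr
    omega

/-! ### Candidate hyperedges and nestedness -/

section

variable [Fintype V]

open Classical in
/-- The common neighbours of `x` and `y`. -/
noncomputable def commonNbrs (G : SimpleGraph V) (x y : V) : Finset V :=
  Finset.univ.filter fun z => G.Adj x z ∧ G.Adj y z

@[simp] theorem mem_commonNbrs {x y z : V} : z ∈ commonNbrs G x y ↔ G.Adj x z ∧ G.Adj y z := by
  simp [commonNbrs]

variable [DecidableEq V]

/-- The hyperedges on `A` that the enumeration has to consider. -/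
def Cand (G : SimpleGraph V) (S A e : Finset V) : Prop :=
  e = A ∨ ∃ x ∈ S, ∃ y ∈ S, e = commonNbrs G x y

/-- Each set that cannot be completed by `T ⊆ A` misses a candidate that every completion hits. -/
def Rich (G : SimpleGraph V) (S A : Finset V) : Prop :=
  ∀ B ⊆ S, ∀ T ⊆ A, IsConnectedDominatingSet G (B ∪ A) → ¬ IsConnectedDominatingSet G (B ∪ T) →
    ∃ e, Cand G S A e ∧ Disjoint e T ∧ ¬ IsConnectedDominatingSet G ((B ∪ A) \ e)

/-- The traces on `e` of the sets in `F` form a chain. -/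
def Nested (F : List (Finset V)) (e : Finset V) : Prop :=
  ∀ f ∈ F, ∀ g ∈ F, f ∩ e ⊆ g ∨ g ∩ e ⊆ f

/-- Among the traces on `R` of candidates there is always one on which the others form a chain. -/
def HasNested (G : SimpleGraph V) (S A : Finset V) : Prop :=
  ∀ (R : Finset V) (F : List (Finset V)), F ≠ [] → (∀ f ∈ F, ∃ e, Cand G S A e ∧ f = e ∩ R) →
    ∃ e ∈ F, Nested F e

/-- Here the traces are intervals of W ∩ R. Choose the interval e that ends first. Any other
interval that meets e extends at least to the end of e, so it cuts out a final segment of e, and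
final segments form a chain. -/
theorem hasNested_right {U W : Finset V} (hs : Sides G U W) {pos : V → ℕ}
    (hp : ConvexOrder G W pos) : HasNested G U W := by
  intro R F hF hc
  have hconv : ∀ f ∈ F, ∀ a ∈ f, ∀ c ∈ f, ∀ b ∈ W, b ∈ R → pos a ≤ pos b → pos b ≤ pos c →
      b ∈ f := by
    intro f hf a ha c hcf b hb hbR hab hbc
    obtain ⟨e, he, rfl⟩ := hc f hf
    rw [Finset.mem_inter] at *
    refine ⟨?_, hbR⟩
    rcases he with rfl | ⟨x, hx, y, hy, rfl⟩
    · exact hb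
    · rw [mem_commonNbrs] at *
      have h1 := hs.adj_left ha.1.1 hx
      have h2 := hs.adj_left hcf.1.1 hx
      exact ⟨hp.conv ha.1.1 hcf.1.1 h1 hb h2 hab hbc, hp.conv ha.1.2 hcf.1.2 h1 hb h2 hab hbc⟩
  have hW : ∀ f ∈ F, ∀ a ∈ f, a ∈ W ∧ a ∈ R := by
    intro f hf a ha
    obtain ⟨e, he, rfl⟩ := hc f hf
    rw [Finset.mem_inter] at ha
    refine ⟨?_, ha.2⟩
    rcases he with rfl | ⟨x, hx, y, hy, rfl⟩
    · exact ha.1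
    · exact hs.adj_left (mem_commonNbrs.1 ha.1).1 hx
  obtain ⟨e, he, hmin⟩ := F.toFinset.exists_min_image (fun f => f.sup pos)
    (by simpa [List.toFinset_nonempty_iff] using hF)
  rw [List.mem_toFinset] at he
  refine ⟨e, he, ?_⟩
  have key : ∀ f ∈ F, ∀ x ∈ f, ∀ y ∈ e, pos x ≤ pos y → y ∈ f := by
    intro f hf x hx y hy hxy
    obtain ⟨z, hz, hzs⟩ := Finset.exists_mem_eq_sup f ⟨x, hx⟩ pos
    have h1 : pos y ≤ pos z := by
      rw [← hzs]
      exact (Finset.le_sup (f := pos) hy).trans (hmin f (by simpa using hf))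
    exact hconv f hf x hx z hz y (hW e he y hy).1 (hW e he y hy).2 hxy h1
  intro f hf g hg
  by_contra hcon
  simp only [not_or, Finset.not_subset, Finset.mem_inter] at hcon
  obtain ⟨⟨x, ⟨hxf, hxe⟩, hxg⟩, y, ⟨hyg, hye⟩, hyf⟩ := hcon
  rcases le_total (pos x) (pos y) with hxy | hxy
  · exact hyf (key f hf x hxf y hye hxy)
  · exact hxg (key g hg y hyg x hxe hxy)

/-- Here N(a) ∩ N(b) consists of the u whose interval covers a and b. Choose e with the smallest
left end a. For another candidate with ends c ≤ d one has a ≤ c, so an element of e, being adjacent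
to a, belongs to it exactly when it is adjacent to d. The traces on e thus shrink as d moves to the
right. -/
theorem hasNested_left {U W : Finset V} (hs : Sides G U W) {pos : V → ℕ}
    (hp : ConvexOrder G W pos) : HasNested G W U := by
  intro R F hF hc
  let Good : Finset V → V → V → Prop := fun f a b =>
    a ∈ W ∧ b ∈ W ∧ pos a ≤ pos b ∧ f = commonNbrs G a b ∩ R
  have hgood : ∀ f ∈ F, f = U ∩ R ∨ ∃ a b, Good f a b := by
    intro f hf
    obtain ⟨e, he, rfl⟩ := hc f hf
    rcases he with rfl | ⟨x, hx, y, hy, rfl⟩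
    · exact Or.inl rfl
    · right
      rcases le_total (pos x) (pos y) with h | h
      · exact ⟨x, y, hx, hy, h, rfl⟩
      · exact ⟨y, x, hy, hx, h, by ext z; simp [and_comm]⟩
  have hUR : ∀ f ∈ F, f ⊆ U ∩ R := by
    intro f hf z hz
    obtain ⟨e, he, rfl⟩ := hc f hf
    rw [Finset.mem_inter] at *
    refine ⟨?_, hz.2⟩
    rcases he with rfl | ⟨x, hx, y, hy, rfl⟩
    · exact hz.1
    · exact hs.symm.adj_left (mem_commonNbrs.1 hz.1).1 hx
  classical
  by_cases hex : ∃ f ∈ F, ∃ a b, Good f a b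
  · obtain ⟨f₀, hf₀, a₀, b₀, h₀⟩ := hex
    obtain ⟨⟨e, a⟩, hea, hmin⟩ :=
      ((F.toFinset ×ˢ (Finset.univ : Finset V)).filter
        fun q : Finset V × V => ∃ b, Good q.1 q.2 b).exists_min_image (fun q => pos q.2)
        ⟨(f₀, a₀), by simpa using ⟨hf₀, b₀, h₀⟩⟩
    simp only [Finset.mem_filter, Finset.mem_product, List.mem_toFinset, Finset.mem_univ,
      and_true, Prod.forall, and_imp] at hea hmin
    obtain ⟨he, b, ha, hb, hab, hee⟩ := hea
    refine ⟨e, he, fun f hf g hg => ?_⟩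
    rcases hgood f hf with rfl | ⟨c, d, hcd⟩
    -- The candidate U contains every other trace, so it never breaks the chain.
    · exact Or.inr (Finset.inter_subset_left.trans (hUR g hg))
    rcases hgood g hg with rfl | ⟨c', d', hcd'⟩
    · exact Or.inl (Finset.inter_subset_left.trans (hUR f hf))
    have hac := hmin f c hf ⟨d, hcd⟩
    have hac' := hmin g c' hg ⟨d', hcd'⟩
    by_contra hcon
    simp only [not_or, Finset.not_subset, Finset.mem_inter] at hcon
    obtain ⟨⟨x, ⟨hxf, hxe⟩, hxg⟩, y, ⟨hyg, hye⟩, hyf⟩ := hcon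
    obtain ⟨hc1, hd1, hcd1, rfl⟩ := hcd
    obtain ⟨hc2, hd2, hcd2, rfl⟩ := hcd'
    rw [hee] at hxe hye
    simp only [Finset.mem_inter, mem_commonNbrs] at hxf hxe hyg hye hxg hyf
    rcases le_total (pos d) (pos d') with hdd | hdd
    · refine hyf ⟨⟨?_, ?_⟩, hye.2⟩
      · exact (hp.conv hye.1.1.symm hyg.1.2.symm ha hc1 hd2 hac (hcd1.trans hdd)).symm
      · exact (hp.conv hye.1.1.symm hyg.1.2.symm ha hd1 hd2 (hac.trans hcd1) hdd).symm
    · refine hxg ⟨⟨?_, ?_⟩, hxe.2⟩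
      · exact (hp.conv hxe.1.1.symm hxf.1.2.symm ha hc2 hd1 hac' (hcd2.trans hdd)).symm
      · exact (hp.conv hxe.1.1.symm hxf.1.2.symm ha hd2 hd1 (hac'.trans hcd2) hdd).symm
  · have hall : ∀ f ∈ F, f = U ∩ R := fun f hf =>
      (hgood f hf).resolve_right fun h => hex ⟨f, hf, h⟩
    obtain ⟨e, he⟩ := List.exists_mem_of_ne_nil F hF
    exact ⟨e, he, fun f hf g hg => Or.inl (by
      rw [hall f hf, hall g hg]; exact Finset.inter_subset_left)⟩

/-! ### Sets that cannot be completed miss an essential candidate -/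

/-- The part of `Rich` that needs no order. -/
theorem rich_of_consecutive {S A : Finset V} (hs : Sides G S A)
    (h : ∀ B ⊆ S, ∀ T ⊆ A, IsConnectedDominatingSet G (B ∪ A) →
      (∀ x ∈ S, ∃ t ∈ T, G.Adj x t) → (∀ a ∈ A, ∃ b ∈ B, G.Adj a b) →
      ∀ K : V → Prop, (∀ a ∈ B ∪ T, ∀ b ∈ B ∪ T, G.Adj a b → (K a ↔ K b)) →
      (∃ a ∈ B ∪ T, K a) → (∃ a ∈ B ∪ T, ¬ K a) →
      ∃ e, Cand G S A e ∧ Disjoint e T ∧ ¬ IsConnectedDominatingSet G ((B ∪ A) \ e)) :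
    Rich G S A := by
  intro B hB T hT hBA hBT
  have hSA : ∀ {v}, v ∈ S → v ∉ A := fun h1 h2 => Finset.disjoint_left.1 hs.disj h1 h2
  by_cases h1 : ∀ x ∈ S, ∃ t ∈ T, G.Adj x t
  swap
  · push Not at h1
    obtain ⟨x, hx, hxT⟩ := h1
    -- If x has no neighbour in T, the candidate N(x) works. Were its removal harmless, x would have
    -- to remain as an isolated vertex of a connected set, so {x} ⊆ B would already be connected
    -- dominating.
    refine ⟨commonNbrs G x x, Or.inr ⟨x, hx, x, hx, rfl⟩, ?_, fun hc => hBT ?_⟩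
    · rw [Finset.disjoint_left]
      intro a ha haT
      exact hxT a haT (mem_commonNbrs.1 ha).1
    · have hxm : x ∈ (B ∪ A) \ commonNbrs G x x := by
        rcases hc.2 x with h | ⟨w, hw, hxw⟩
        · exact h
        · simp [hxw] at hw
      have hxB : x ∈ B := by
        simp only [Finset.mem_sdiff, Finset.mem_union] at hxm
        exact hxm.1.resolve_right (hSA hx)
      have hreach : ∀ w, ReachThrough G {x} x w := by
        intro w
        have := hc.reachThrough hxm w
        induction this with
        | refl => exact Relation.ReflTransGen.refl
        | @tail b c hb hbc ih =>
          refine Relation.ReflTransGen.tail ih ⟨?_, hbc.2⟩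
          rcases Relation.ReflTransGen.cases_tail ih with rfl | ⟨d, _, hd⟩
          · simp
          · rw [Finset.mem_singleton] at hd
            have := hbc.1
            simp [← hd.1, hd.2] at this
      exact (isConnectedDominatingSet_of_reachThrough (Finset.mem_singleton_self x) hreach).mono
        (by simp [hxB])
  rcases B.eq_empty_or_nonempty with rfl | ⟨b, hb⟩
  -- For B = ∅ the set A is connected and independent, hence a single vertex, and the candidate A
  -- works.
  · obtain ⟨v, hv⟩ := hBA.nonempty
    have hvA : v ∈ A := by simpa using hv
    have hAv : ∀ w ∈ A, w = v := by
      intro w hw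
      rcases Relation.ReflTransGen.cases_tail (hBA.reachThrough hv w) with h | ⟨c, _, hc⟩
      · exact h
      · have hcA : c ∈ A := by simpa using hc.1
        exact absurd hw (hSA (hs.adj_right hc.2 hcA))
    refine ⟨A, Or.inl rfl, ?_, fun hc => by simpa using hc.nonempty⟩
    rw [Finset.disjoint_left]
    intro a ha haT
    refine hBT (hBA.mono ?_)
    intro w hw
    have hwA : w ∈ A := by simpa using hw
    rw [hAv w hwA, ← hAv a ha]
    simpa using haT
  have h2 : ∀ a ∈ A, ∃ b ∈ B, G.Adj a b := by
    intro a ha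
    rcases Relation.ReflTransGen.cases_tail
      (hBA.reachThrough (Finset.mem_union_left A hb) a) with rfl | ⟨c, _, hc⟩
    · exact absurd ha (hSA (hB hb))
    · have hcS := hs.adj_right hc.2.symm ha
      exact ⟨c, (Finset.mem_union.1 hc.1).resolve_right (hSA hcS), hc.2.symm⟩
  have hbm : b ∈ B ∪ T := Finset.mem_union_left T hb
  -- All vertices are now dominated by B ∪ T, so the failure is one of connectivity. K is the part
  -- of B ∪ T that is reachable from b.
  refine h B hB T hT hBA h1 h2 (ReachThrough G (B ∪ T) b) ?_
    ⟨b, hbm, Relation.ReflTransGen.refl⟩ ?_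
  · intro x hx y hy hxy
    exact ⟨fun h => Relation.ReflTransGen.tail h ⟨hx, hxy⟩,
      fun h => Relation.ReflTransGen.tail h ⟨hy, hxy.symm⟩⟩
  · by_contra! hcon
    refine hBT (isConnectedDominatingSet_of_reachThrough hbm fun w => ?_)
    obtain ⟨z, hz, hwz⟩ : ∃ z ∈ B ∪ T, G.Adj w z := by
      rcases hs.cover w with hw | hw
      · obtain ⟨t, ht, hwt⟩ := h1 w hw
        exact ⟨t, Finset.mem_union_right B ht, hwt⟩
      · obtain ⟨t, ht, hwt⟩ := h2 w hw
        exact ⟨t, Finset.mem_union_left T ht, hwt⟩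
    exact Relation.ReflTransGen.tail (hcon z hz) ⟨hz, hwz.symm⟩

/-- Each chosen vertex of U sees a chosen vertex of W, so K separates two consecutive chosen
vertices p, q of W. No chosen vertex of U is adjacent to both. After N(p) ∩ N(q) is deleted, no
interval bridges the gap, since by convexity it would contain both p and q. -/
theorem rich_left {U W : Finset V} (hs : Sides G U W) {pos : V → ℕ}
    (hp : ConvexOrder G W pos) : Rich G W U := by
  refine rich_of_consecutive hs.symm ?_
  intro P hPW I hIU hPU hWI hUP K hK ⟨a, ha, hKa⟩ ⟨b, hb, hKb⟩
  have hUW : ∀ {v}, v ∈ U → v ∉ W := fun h1 h2 => Finset.disjoint_left.1 hs.disj h1 h2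
  have toP : ∀ d ∈ P ∪ I, ∃ p ∈ P, K d ↔ K p := by
    intro d hd
    rcases Finset.mem_union.1 hd with h | h
    · exact ⟨d, h, Iff.rfl⟩
    · obtain ⟨p, hpP, hdp⟩ := hUP d (hIU h)
      exact ⟨p, hpP, hK d hd p (Finset.mem_union_left I hpP) hdp⟩
  obtain ⟨a', ha', haa⟩ := toP a ha
  obtain ⟨b', hb', hbb⟩ := toP b hb
  obtain ⟨p, hpP, q, hqP, hpq, hKpq, hcons⟩ := exists_consecutive P pos
    (hp.inj.mono (by exact_mod_cast hPW)) K ha' hb' (haa.1 hKa) (fun h => hKb (hbb.2 h))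
  refine ⟨commonNbrs G p q, Or.inr ⟨p, hPW hpP, q, hPW hqP, rfl⟩, ?_, ?_⟩
  · rw [Finset.disjoint_left]
    intro u hu huI
    rw [mem_commonNbrs] at hu
    have hum : u ∈ P ∪ I := Finset.mem_union_right P huI
    exact hKpq ((hK p (Finset.mem_union_left I hpP) u hum hu.1).trans
      (hK u hum q (Finset.mem_union_left I hqP) hu.2.symm))
  · have hmem : ∀ r ∈ P, r ∈ (P ∪ U) \ commonNbrs G p q := by
      intro r hr
      refine Finset.mem_sdiff.2 ⟨Finset.mem_union_left U hr, fun h => ?_⟩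
      exact hUW (hs.adj_right (mem_commonNbrs.1 h).1 (hPW hpP)) (hPW hr)
    -- The cut consists of the part of W up to p together with the vertices of U that see a chosen
    -- vertex there.
    refine not_isConnectedDominatingSet_of_cut
      (fun z => (z ∈ W ∧ pos z ≤ pos p) ∨ (z ∈ U ∧ ∃ r ∈ P, G.Adj z r ∧ pos r ≤ pos p)) ?_
      (hmem p hpP) (hmem q hqP) (Or.inl ⟨hPW hpP, le_rfl⟩) ?_
    · rintro x hx y hy hxy (⟨hxW, hxp⟩ | ⟨hxU, r, hr, hxr, hrp⟩)
      · have hxP : x ∈ P := by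
          simp only [Finset.mem_sdiff, Finset.mem_union] at hx
          exact hx.1.resolve_right fun h => hUW h hxW
        exact Or.inr ⟨hs.adj_right hxy hxW, x, hxP, hxy.symm, hxp⟩
      · have hyW := hs.adj_left hxy hxU
        have hyP : y ∈ P := by
          simp only [Finset.mem_sdiff, Finset.mem_union] at hy
          exact hy.1.resolve_right fun h => hUW h hyW
        refine Or.inl ⟨hyW, (hcons y hyP).resolve_right fun hqy => ?_⟩
        have h1 := hp.conv hxr hxy (hPW hr) (hPW hpP) hyW hrp (hpq.le.trans hqy)
        have h2 := hp.conv hxr hxy (hPW hr) (hPW hqP) hyW (hrp.trans hpq.le) hqy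
        simp [h1.symm, h2.symm] at hx
    · rintro (⟨_, h⟩ | ⟨h, _⟩)
      · omega
      · exact hUW h (hPW hqP)

/-- Again K separates consecutive p, q in P. Among the vertices of I, let u₁ be the neighbour of p
reaching farthest right and u₂ the neighbour of q reaching farthest left. Any vertex of W between p
and q that joins the two sides is adjacent to both u₁ and u₂, so deleting N(u₁) ∩ N(u₂) disconnects.
P avoids this set, because a common neighbour in P lies at or beyond p or q and would yield a vertex
of I adjacent to both. -/
theorem rich_right {U W : Finset V} (hs : Sides G U W) {pos : V → ℕ}
    (hp : ConvexOrder G W pos) : Rich G U W := by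
  refine rich_of_consecutive hs ?_
  intro I hIU P hPW hIW hUP hWI K hK ⟨a, ha, hKa⟩ ⟨b, hb, hKb⟩
  classical
  have hUW : ∀ {v}, v ∈ U → v ∉ W := fun h1 h2 => Finset.disjoint_left.1 hs.disj h1 h2
  have toP : ∀ d ∈ I ∪ P, ∃ p ∈ P, K d ↔ K p := by
    intro d hd
    rcases Finset.mem_union.1 hd with h | h
    · obtain ⟨p, hpP, hdp⟩ := hUP d (hIU h)
      exact ⟨p, hpP, hK d hd p (Finset.mem_union_right I hpP) hdp⟩
    · exact ⟨d, h, Iff.rfl⟩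
  obtain ⟨a', ha', haa⟩ := toP a ha
  obtain ⟨b', hb', hbb⟩ := toP b hb
  obtain ⟨p, hpP, q, hqP, hpq, hKpq, hcons⟩ := exists_consecutive P pos
    (hp.inj.mono (by exact_mod_cast hPW)) K ha' hb' (haa.1 hKa) (fun h => hKb (hbb.2 h))
  have hpW := hPW hpP
  have hqW := hPW hqP
  have hcommon : ∀ u ∈ I, G.Adj u p → G.Adj u q → False := by
    intro u hu h1 h2
    have hum : u ∈ I ∪ P := Finset.mem_union_left P hu
    exact hKpq ((hK p (Finset.mem_union_right I hpP) u hum h1.symm).trans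
      (hK u hum q (Finset.mem_union_right I hqP) h2))
  obtain ⟨u₁, z₁, hu₁, hp₁, hz₁, hmax⟩ : ∃ u z, u ∈ I ∧ G.Adj u p ∧ G.Adj u z ∧
      ∀ u' ∈ I, ∀ z', G.Adj u' p → G.Adj u' z' → pos z' ≤ pos z := by
    obtain ⟨u₀, hu₀, hpu₀⟩ := hWI p hpW
    obtain ⟨⟨u, z⟩, huz, hm⟩ := ((I ×ˢ (Finset.univ : Finset V)).filter
      fun x : V × V => G.Adj x.1 p ∧ G.Adj x.1 x.2).exists_max_image (fun x => pos x.2)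
      ⟨(u₀, p), by simp [hu₀, hpu₀.symm]⟩
    simp only [Finset.mem_filter, Finset.mem_product, Finset.mem_univ, and_true, Prod.forall,
      and_imp] at huz hm
    exact ⟨u, z, huz.1, huz.2.1, huz.2.2, fun u' hu' z' => hm u' z' hu'⟩
  obtain ⟨u₂, z₂, hu₂, hq₂, hz₂, hmin⟩ : ∃ u z, u ∈ I ∧ G.Adj u q ∧ G.Adj u z ∧
      ∀ u' ∈ I, ∀ z', G.Adj u' q → G.Adj u' z' → pos z ≤ pos z' := by
    obtain ⟨u₀, hu₀, hqu₀⟩ := hWI q hqW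
    obtain ⟨⟨u, z⟩, huz, hm⟩ := ((I ×ˢ (Finset.univ : Finset V)).filter
      fun x : V × V => G.Adj x.1 q ∧ G.Adj x.1 x.2).exists_min_image (fun x => pos x.2)
      ⟨(u₀, q), by simp [hu₀, hqu₀.symm]⟩
    simp only [Finset.mem_filter, Finset.mem_product, Finset.mem_univ, and_true, Prod.forall,
      and_imp] at huz hm
    exact ⟨u, z, huz.1, huz.2.1, huz.2.2, fun u' hu' z' => hm u' z' hu'⟩
  have adjW : ∀ {u w}, u ∈ I → G.Adj u w → w ∈ W := fun hu h => hs.adj_left h (hIU hu)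
  have hmem : ∀ u ∈ I, u ∈ (I ∪ W) \ commonNbrs G u₁ u₂ := by
    intro u hu
    refine Finset.mem_sdiff.2 ⟨Finset.mem_union_left W hu, fun h => ?_⟩
    exact hUW (hIU hu) (adjW hu₁ (mem_commonNbrs.1 h).1)
  have hI : ∀ {x}, x ∈ (I ∪ W) \ commonNbrs G u₁ u₂ → x ∈ U → x ∈ I := by
    intro x hx hxU
    simp only [Finset.mem_sdiff, Finset.mem_union] at hx
    exact hx.1.resolve_right (hUW hxU)
  refine ⟨commonNbrs G u₁ u₂, Or.inr ⟨u₁, hIU hu₁, u₂, hIU hu₂, rfl⟩, ?_, ?_⟩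
  · rw [Finset.disjoint_left]
    intro x hx hxP
    rw [mem_commonNbrs] at hx
    rcases hcons x hxP with h | h
    · exact hcommon u₂ hu₂ (hp.conv hx.2 hq₂ (hPW hxP) hpW hqW h hpq.le) hq₂
    · exact hcommon u₁ hu₁ hp₁ (hp.conv hp₁ hx.1 hpW hqW (hPW hxP) hpq.le h)
  · let Lft : V → Prop := fun u => ∃ x, G.Adj u x ∧ pos x ≤ pos p
    refine not_isConnectedDominatingSet_of_cut
      (fun z => (z ∈ U ∧ Lft z) ∨ (z ∈ W ∧ ∃ u ∈ I, G.Adj u z ∧ Lft u)) ?_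
      (hmem u₁ hu₁) (hmem u₂ hu₂) (Or.inl ⟨hIU hu₁, p, hp₁, le_rfl⟩) ?_
    · rintro x hx y hy hxy (⟨hxU, hxL⟩ | ⟨hxW, u, huI, hux, r, hur, hrp⟩)
      · exact Or.inr ⟨hs.adj_left hxy hxU, x, hI hx hxU, hxy, hxL⟩
      · have hyU := hs.adj_right hxy hxW
        have hyI := hI hy hyU
        refine Or.inl ⟨hyU, ?_⟩
        -- An edge leaving the cut runs from x to y, where u lies on the left side and sees x, and y
        -- sees nothing up to p. Convexity puts x strictly between p and q. The neighbour t of y in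
        -- P lies at or beyond q, so y sees q. Then u₁ and u₂ both see x, and x has been deleted.
        by_contra hyL
        have hyL' : ∀ z, G.Adj y z → pos p < pos z := by
          intro z hz
          by_contra! h
          exact hyL ⟨z, hz, h⟩
        have hpx := hyL' x hxy.symm
        have hup : G.Adj u p := hp.conv hur hux (adjW huI hur) hpW hxW hrp hpx.le
        have hx₁ : G.Adj u₁ x :=
          hp.conv hp₁ hz₁ hpW hxW (adjW hu₁ hz₁) hpx.le (hmax u huI x hup hux)
        have hxq : pos x < pos q := by
          by_contra! h
          exact hcommon u huI hup (hp.conv hup hux hpW hqW hxW hpq.le h)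
        obtain ⟨t, htP, hyt⟩ := hUP y hyU
        have hqt : pos q ≤ pos t := (hcons t htP).resolve_left fun h => by
          have := hyL' t hyt
          omega
        have hyq : G.Adj y q := hp.conv hxy.symm hyt hxW hqW (hPW htP) hxq.le hqt
        have hx₂ : G.Adj u₂ x :=
          hp.conv hz₂ hq₂ (adjW hu₂ hz₂) hxW hqW (hmin y hyI x hyq hxy.symm) hxq.le
        simp [hx₁, hx₂] at hx
    · rintro (⟨_, x, hx, hxp⟩ | ⟨h, _⟩)
      · exact hcommon u₂ hu₂ (hp.conv hx hq₂ (adjW hu₂ hx) hpW hqW hxp hpq.le) hq₂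
      · exact hUW (hIU hu₂) h

end

end Sides

/-! ### Minimal transversals and branching -/

section Transversals

variable {V : Type*} [DecidableEq V]

/-- `T` hits each set in `H`, and each element of `T` is the only one of `T` in some set of `H`. -/
def IsMinimalTransversal (H : List (Finset V)) (T : Finset V) : Prop :=
  (∀ f ∈ H, ¬ Disjoint f T) ∧ ∀ x ∈ T, ∃ f ∈ H, f ∩ T = {x}

theorem IsMinimalTransversal.eq_empty {T : Finset V} (h : IsMinimalTransversal [] T) : T = ∅ := by
  refine Finset.eq_empty_of_forall_notMem fun x hx => ?_
  obtain ⟨f, hf, _⟩ := h.2 x hx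
  simp at hf

open Classical in
/-- The sets that remain to be hit after `x` has been chosen from `e`. -/
noncomputable def residualEdges (H : List (Finset V)) (e : Finset V) (x : V) : List (Finset V) :=
  (H.filter fun f => x ∉ f).map fun f => f \ e

/-- If T contained two vertices x, y of e, the chain condition applied to their private sets f and g
would put x into g or y into f, so one of them would not be private. Hence T ∩ e = {x}. The sets
avoiding x are then hit outside e, and discarding e from them loses nothing. -/
theorem IsMinimalTransversal.exists_residual {H : List (Finset V)} {T e : Finset V}
    (h : IsMinimalTransversal H T) (he : e ∈ H) (hn : Nested H e) :
    ∃ x ∈ e, x ∈ T ∧ IsMinimalTransversal (residualEdges H e x) (T.erase x) := by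
  obtain ⟨x, hxe, hxT⟩ := Finset.not_disjoint_iff.1 (h.1 e he)
  have huniq : ∀ y ∈ T, y ∈ e → y = x := by
    intro y hyT hye
    by_contra hyx
    obtain ⟨f, hf, hfx⟩ := h.2 x hxT
    obtain ⟨g, hg, hgy⟩ := h.2 y hyT
    have hxf : x ∈ f ∩ T := by simp [hfx]
    have hyg : y ∈ g ∩ T := by simp [hgy]
    rw [Finset.mem_inter] at hxf hyg
    rcases hn f hf g hg with hs | hs
    · have : x ∈ g ∩ T := Finset.mem_inter.2 ⟨hs (Finset.mem_inter.2 ⟨hxf.1, hxe⟩), hxT⟩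
      rw [hgy, Finset.mem_singleton] at this
      exact hyx this.symm
    · have : y ∈ f ∩ T := Finset.mem_inter.2 ⟨hs (Finset.mem_inter.2 ⟨hyg.1, hye⟩), hyT⟩
      rw [hfx, Finset.mem_singleton] at this
      exact hyx this
  refine ⟨x, hxe, hxT, ?_, ?_⟩
  · intro f' hf'
    simp only [residualEdges, List.mem_map, List.mem_filter, decide_eq_true_eq] at hf'
    obtain ⟨f, ⟨hf, hxf⟩, rfl⟩ := hf'
    obtain ⟨z, hzf, hzT⟩ := Finset.not_disjoint_iff.1 (h.1 f hf)
    have hzx : z ≠ x := fun h => hxf (h ▸ hzf)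
    exact Finset.not_disjoint_iff.2 ⟨z, Finset.mem_sdiff.2 ⟨hzf, fun hze => hzx (huniq z hzT hze)⟩,
      Finset.mem_erase.2 ⟨hzx, hzT⟩⟩
  · intro y hy
    rw [Finset.mem_erase] at hy
    obtain ⟨f, hf, hfy⟩ := h.2 y hy.2
    have hxf : x ∉ f := fun hxf => by
      have : x ∈ f ∩ T := Finset.mem_inter.2 ⟨hxf, hxT⟩
      rw [hfy, Finset.mem_singleton] at this
      exact hy.1 this.symm
    refine ⟨f \ e, ?_, ?_⟩
    · simp only [residualEdges, List.mem_map, List.mem_filter, decide_eq_true_eq]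
      exact ⟨f, ⟨hf, hxf⟩, rfl⟩
    · have hyf : y ∈ f ∩ T := by simp [hfy]
      rw [Finset.mem_inter] at hyf
      ext z
      simp only [Finset.mem_inter, Finset.mem_sdiff, Finset.mem_erase, Finset.mem_singleton]
      constructor
      · rintro ⟨⟨hzf, _⟩, _, hzT⟩
        have : z ∈ f ∩ T := Finset.mem_inter.2 ⟨hzf, hzT⟩
        rwa [hfy, Finset.mem_singleton] at this
      · rintro rfl
        exact ⟨⟨hyf.1, fun hze => hy.1 (huniq z hyf.2 hze)⟩, hy.1, hyf.2⟩

end Transversals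

namespace Lisp

/-! ### Evaluation with an upper bound for the number of steps -/

/-- Evaluation within at most `K` steps. -/
def Ev (P : Program) (e : List Data) (t : Term) (d : Data) (K : ℕ) : Prop :=
  ∃ k ≤ K, Eval P e t d k

section Ev

variable {P : Program} {e : List Data} {s t c : Term} {a b d : Data} {k l m : ℕ}

theorem Ev.mono (h : Ev P e t d k) (hkl : k ≤ l) : Ev P e t d l :=
  h.imp fun _ hk => ⟨hk.1.trans hkl, hk.2⟩

theorem Ev.cons (hs : Ev P e s a k) (ht : Ev P e t b l) :
    Ev P e (.cons s t) (.cons a b) (k + l + 1) := by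
  obtain ⟨k', hk, hs⟩ := hs
  obtain ⟨l', hl, ht⟩ := ht
  exact ⟨_, by omega, .cons hs ht⟩

theorem Ev.bind (hs : Ev P e s a k) (ht : Ev P (a :: e) t b l) :
    Ev P e (.bind s t) b (k + l + 1) := by
  obtain ⟨k', hk, hs⟩ := hs
  obtain ⟨l', hl, ht⟩ := ht
  exact ⟨_, by omega, .bind hs ht⟩

theorem Ev.ite_nil (hc : Ev P e c .nil k) (ht : Ev P e t a l) :
    Ev P e (.ite c s t) a (k + l + 1) := by
  obtain ⟨k', hk, hc⟩ := hc
  obtain ⟨l', hl, ht⟩ := ht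
  exact ⟨_, by omega, .ite_nil hc ht⟩

theorem Ev.ite_cons (hc : Ev P e c (.cons b d) k) (hs : Ev P e s a l) :
    Ev P e (.ite c s t) a (k + l + 1) := by
  obtain ⟨k', hk, hc⟩ := hc
  obtain ⟨l', hl, hs⟩ := hs
  exact ⟨_, by omega, .ite_cons hc hs⟩

/-- The two costs are added rather than maximised, so the bound does not depend on p, and each
branch may use the outcome of the test. -/
theorem Ev.ite {p : Prop} (hc : Ev P e c (Data.ofProp p) k) (hs : p → Ev P e s a l)
    (ht : ¬ p → Ev P e t a m) : Ev P e (.ite c s t) a (k + (l + m) + 1) := by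
  by_cases hp : p
  · rw [Data.ofProp, if_pos hp] at hc
    exact (hc.ite_cons (hs hp)).mono (by omega)
  · rw [Data.ofProp, if_neg hp] at hc
    exact (hc.ite_nil (ht hp)).mono (by omega)

theorem Ev.call {f : ℕ} {body : Term} (hf : P[f]? = some body) (ht : Ev P e t a k)
    (hb : Ev P [a] body b l) : Ev P e (.call f t) b (k + l + 1) := by
  obtain ⟨k', hk, ht⟩ := ht
  obtain ⟨l', hl, hb⟩ := hb
  exact ⟨_, by omega, .call hf ht hb⟩

/-- Terms without tests, bindings and calls, whose variables are below `n`. -/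
def Term.isPure (n : ℕ) : Term → Bool
  | .var i => decide (i < n)
  | .nil => true
  | .cons s t => s.isPure n && t.isPure n
  | .head t => t.isPure n
  | .tail t => t.isPure n
  | _ => false

/-- The value of a pure term. -/
def Term.value (e : List Data) : Term → Data
  | .var i => e.getD i .nil
  | .cons s t => .cons (s.value e) (t.value e)
  | .head t => (t.value e).head
  | .tail t => (t.value e).tail
  | _ => .nil

/-- The number of steps in the evaluation of a pure term. -/
def Term.cost : Term → ℕ
  | .cons s t => s.cost + t.cost + 1
  | .head t => t.cost + 1
  | .tail t => t.cost + 1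
  | _ => 1

/-- For straight-line terms, well-formedness and value are usually settled by computation; only
calls, tests and bindings remain to be handled by hand. -/
theorem Ev.of_isPure (h : t.isPure e.length = true := by rfl) (hd : t.value e = d := by rfl) :
    Ev P e t d t.cost := by
  subst hd
  induction t with
  | var i =>
    simp only [Term.isPure, decide_eq_true_eq] at h
    exact ⟨1, le_rfl, .var (by simp [Term.value, h])⟩
  | nil => exact ⟨1, le_rfl, .nil⟩
  | cons s t ihs iht =>
    simp only [Term.isPure, Bool.and_eq_true] at h
    exact (ihs h.1).cons (iht h.2)
  | head t ih =>
    obtain ⟨k, hk, h'⟩ := ih h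
    exact ⟨_, Nat.succ_le_succ hk, .head h'⟩
  | tail t ih =>
    obtain ⟨k, hk, h'⟩ := ih h
    exact ⟨_, Nat.succ_le_succ hk, .tail h'⟩
  | ite | bind | call => simp [Term.isPure] at h

end Ev

/-! ### Recursion over a list -/

/-- Structural recursion over a list: on `(l . s)` the result is `t₀` if `l` is empty; otherwise
the function is called for the tail of `l` and the new parameter `t₂`, and its result becomes the
variable `0` of `t₁`. -/
def foldBody (i : ℕ) (t₀ t₂ t₁ : Term) : Term :=
  .ite (.head (.var 0)) (.bind (.call i (.cons (.tail (.head (.var 0))) t₂)) t₁) t₀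

section Fold

variable {P : Program} {i : ℕ} {t₀ t₁ t₂ : Term}

theorem Ev.fold_nil {s d : Data} {K : ℕ} (h : Ev P [.cons .nil s] t₀ d K) :
    Ev P [.cons .nil s] (foldBody i t₀ t₂ t₁) d (K + 3) :=
  (Ev.ite_nil Ev.of_isPure h).mono (by simp [Term.cost]; omega)

theorem Ev.fold_cons (hi : P[i]? = some (foldBody i t₀ t₂ t₁)) {a l s s' r d : Data}
    {K K₁ K₂ : ℕ} (h₂ : Ev P [.cons (.cons a l) s] t₂ s' K₂)
    (hr : Ev P [.cons l s'] (foldBody i t₀ t₂ t₁) r K)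
    (h₁ : Ev P [r, .cons (.cons a l) s] t₁ d K₁) :
    Ev P [.cons (.cons a l) s] (foldBody i t₀ t₂ t₁) d (K₁ + K + K₂ + 9) := by
  refine (Ev.ite_cons (b := a) (d := l) Ev.of_isPure
    (Ev.bind (Ev.call hi (Ev.cons (a := l) Ev.of_isPure h₂) hr) h₁)).mono ?_
  simp [Term.cost]
  omega

/-- The bound keeps one cost per element, which matters in the branching, where only the elements of
e are expensive. The 11 is the overhead 9 of `Ev.fold_cons` plus 2 steps for the parameter. -/
theorem Ev.foldr_sum (hi : P[i]? = some (foldBody i t₀ (.tail (.var 0)) t₁)) {α β : Type*}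
    (ea : α → Data) (eb : β → Data) (g : α → β → β) {b₀ : β} {s : Data} {K₀ : ℕ} {K₁ : α → ℕ}
    (h₀ : Ev P [.cons .nil s] t₀ (eb b₀) K₀) (xs : List α)
    (h₁ : ∀ a ∈ xs, ∀ b l,
      Ev P [eb b, .cons (.cons (ea a) l) s] t₁ (eb (g a b)) (K₁ a)) :
    Ev P [.cons (Data.ofList (xs.map ea)) s] (foldBody i t₀ (.tail (.var 0)) t₁)
      (eb (xs.foldr g b₀)) (K₀ + (xs.map fun a => K₁ a + 11).sum + 3) := by
  induction xs with
  | nil => exact (Ev.fold_nil h₀).mono (by simp)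
  | cons a xs ih =>
    refine (Ev.fold_cons hi Ev.of_isPure (ih fun x hx => h₁ x (List.mem_cons_of_mem a hx))
      (h₁ a List.mem_cons_self _ _)).mono ?_
    simp [Term.cost]
    omega

theorem Ev.foldr (hi : P[i]? = some (foldBody i t₀ (.tail (.var 0)) t₁)) {α β : Type*}
    (ea : α → Data) (eb : β → Data) (g : α → β → β) {b₀ : β} {s : Data} {K₀ K₁ N : ℕ}
    (h₀ : Ev P [.cons .nil s] t₀ (eb b₀) K₀) (xs : List α) (hN : xs.length ≤ N)
    (h₁ : ∀ a ∈ xs, ∀ b l,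
      Ev P [eb b, .cons (.cons (ea a) l) s] t₁ (eb (g a b)) K₁) :
    Ev P [.cons (Data.ofList (xs.map ea)) s] (foldBody i t₀ (.tail (.var 0)) t₁)
      (eb (xs.foldr g b₀)) (K₀ + N * (K₁ + 11) + 3) := by
  refine (Ev.foldr_sum hi ea eb g h₀ xs h₁).mono ?_
  have : xs.length * (K₁ + 11) ≤ N * (K₁ + 11) := Nat.mul_le_mul_right _ hN
  simp only [List.map_const', List.sum_replicate, smul_eq_mul]
  omega

end Fold

/-! ### Polynomial bounds -/

/-- Functions bounded by a polynomial. -/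
@[fun_prop]
def Poly (K : ℕ → ℕ) : Prop := ∃ d, ∀ N, K N ≤ (N + 2) ^ d

@[fun_prop]
theorem Poly.const (c : ℕ) : Poly fun _ => c :=
  ⟨c, fun N => (Nat.lt_two_pow_self.le).trans (Nat.pow_le_pow_left (by omega) c)⟩

@[fun_prop]
theorem Poly.id : Poly fun N => N := ⟨1, fun N => by simp⟩

@[fun_prop]
theorem Poly.add {K L : ℕ → ℕ} (hK : Poly K) (hL : Poly L) : Poly fun N => K N + L N := by
  obtain ⟨c, hc⟩ := hK
  obtain ⟨d, hd⟩ := hL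
  refine ⟨max c d + 1, fun N => ?_⟩
  have h1 := (hc N).trans (Nat.pow_le_pow_right (by omega : 0 < N + 2) (le_max_left c d))
  have h2 := (hd N).trans (Nat.pow_le_pow_right (by omega : 0 < N + 2) (le_max_right c d))
  rw [pow_succ]
  nlinarith

@[fun_prop]
theorem Poly.mul {K L : ℕ → ℕ} (hK : Poly K) (hL : Poly L) : Poly fun N => K N * L N := by
  obtain ⟨c, hc⟩ := hK
  obtain ⟨d, hd⟩ := hL
  exact ⟨c + d, fun N => by rw [pow_add]; exact Nat.mul_le_mul (hc N) (hd N)⟩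

/-- Needed to substitute the quadratic bound on the number of hyperedges into the cost of a
branching node. -/
theorem Poly.comp {K L : ℕ → ℕ} (hK : Poly K) (hL : Poly L) : Poly fun N => K (L N) := by
  obtain ⟨c, hc⟩ := hK
  obtain ⟨d, hd⟩ := hL
  have h2 : ∀ N, L N + 2 ≤ (N + 2) ^ (d + 2) := fun N => by
    have := hd N
    have h1 : 1 ≤ (N + 2) ^ d := Nat.one_le_pow _ _ (by omega)
    rw [pow_add]
    nlinarith [Nat.zero_le N, Nat.pow_le_pow_left (show 2 ≤ N + 2 by omega) 2]
  exact ⟨(d + 2) * c, fun N => (hc _).trans (by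
    rw [pow_mul]; exact Nat.pow_le_pow_left (h2 N) c)⟩

/-- Any base above 1 absorbs a polynomial; r will be the ratio of 1.7254 to the true branching base
1.703. -/
theorem Poly.exists_le {K : ℕ → ℕ} (hK : Poly K) {r : ℝ} (hr : 1 < r) :
    ∃ C : ℝ, ∀ N, (K N : ℝ) ≤ C * r ^ N := by
  obtain ⟨d, hd⟩ := hK
  have h1 : (fun N : ℕ => (N : ℝ) ^ d) =O[Filter.atTop] fun N => r ^ N :=
    (isLittleO_pow_const_const_pow_of_one_lt d hr).isBigO
  have h2 : (fun N : ℕ => ((N + 2 : ℕ) : ℝ) ^ d) =O[Filter.atTop] fun N : ℕ => r ^ (N + 2) :=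
    h1.comp_tendsto (Filter.tendsto_add_atTop_nat 2)
  obtain ⟨C, _, hC⟩ := Asymptotics.bound_of_isBigO_nat_atTop h2
  refine ⟨C * r ^ 2, fun N => ?_⟩
  have h3 := hC (x := N) (by positivity)
  rw [Real.norm_of_nonneg (by positivity), Real.norm_of_nonneg (by positivity)] at h3
  calc (K N : ℝ) ≤ ((N + 2 : ℕ) : ℝ) ^ d := by exact_mod_cast hd N
    _ ≤ C * r ^ (N + 2) := h3
    _ = C * r ^ 2 * r ^ N := by ring

/-! ### The size of the output -/

/-- The height of a tree. -/
def Data.height : Data → ℕ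
  | .nil => 0
  | .cons a b => max a.height b.height + 1

theorem Data.height_head_le (a : Data) : a.head.height ≤ a.height := by
  cases a <;> simp [Data.head, Data.height]; omega

theorem Data.height_tail_le (a : Data) : a.tail.height ≤ a.height := by
  cases a <;> simp [Data.tail, Data.height]; omega

/-- A step creates at most one cell, so it adds at most one level to the highest tree available.
Since a list is at most as long as its tree is high, the running time bounds the number of sets in
the output. -/
theorem Eval.height_le {P : Program} {e : List Data} {t : Term} {d : Data} {k : ℕ}
    (h : Eval P e t d k) : ∀ H, (∀ a ∈ e, a.height ≤ H) → d.height ≤ H + k := by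
  induction h with
  | var ha => exact fun H hH => (hH _ (List.mem_of_getElem? ha)).trans (by omega)
  | nil => simp [Data.height]
  | cons _ _ ihs iht =>
    intro H hH
    have := ihs H hH
    have := iht H hH
    simp only [Data.height]
    omega
  | head _ ih => exact fun H hH => (Data.height_head_le _).trans ((ih H hH).trans (by omega))
  | tail _ ih => exact fun H hH => (Data.height_tail_le _).trans ((ih H hH).trans (by omega))
  | ite_nil _ _ _ ih => exact fun H hH => (ih H hH).trans (by omega)
  | ite_cons _ _ _ ih => exact fun H hH => (ih H hH).trans (by omega)
  | @bind e s t a b k l _ _ ihs iht =>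
    intro H hH
    have h1 := ihs H hH
    have := iht (H + k) (by
      intro x hx
      rcases List.mem_cons.1 hx with rfl | hx
      · exact h1
      · exact (hH x hx).trans (by omega))
    omega
  | @call e f body t a b k l _ _ _ iht ihb =>
    intro H hH
    have h1 := iht H hH
    have := ihb (H + k) (by
      intro x hx
      rw [List.mem_singleton] at hx
      exact hx ▸ h1)
    omega

theorem Data.length_le_height (l : List Data) : l.length ≤ (Data.ofList l).height := by
  induction l with
  | nil => simp
  | cons a l ih => simp only [Data.ofList, Data.height, List.length_cons]; omega

theorem Data.height_ofList_le (l : List Data) (H : ℕ) (h : ∀ a ∈ l, a.height ≤ H) :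
    (Data.ofList l).height ≤ H + l.length := by
  induction l with
  | nil => simp [Data.ofList, Data.height]
  | cons a l ih =>
    have h1 := h a List.mem_cons_self
    have h2 := ih fun x hx => h x (List.mem_cons_of_mem a hx)
    simp only [Data.ofList, Data.height, List.length_cons]
    omega

theorem Data.height_ofProp_le (p : Prop) : (Data.ofProp p).height ≤ 1 := by
  by_cases hp : p <;> simp [Data.ofProp, hp, Data.height]

theorem Data.height_ofVertexSet_le {n : ℕ} (S : Finset (Fin n)) :
    (Data.ofVertexSet S).height ≤ 1 + n := by
  refine (Data.height_ofList_le _ 1 ?_).trans (by simp)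
  simp only [List.forall_mem_ofFn_iff]
  exact fun _ => Data.height_ofProp_le _

theorem Data.height_ofGraph_le {n : ℕ} (G : SimpleGraph (Fin n)) (U : Finset (Fin n)) :
    (Data.ofGraph G U).height ≤ 2 * n + 2 := by
  have h1 := Data.height_ofVertexSet_le U
  have h2 := Data.height_ofList_le (List.ofFn fun v : Fin n =>
      Data.ofList (List.ofFn fun w : Fin n => Data.ofProp (G.Adj v w))) (1 + n) (by
    simp only [List.forall_mem_ofFn_iff]
    intro v
    refine (Data.height_ofList_le _ 1 ?_).trans (by simp)
    simp only [List.forall_mem_ofFn_iff]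
    exact fun _ => Data.height_ofProp_le _)
  rw [List.length_ofFn] at h2
  simp only [Data.ofGraph, Data.height]
  omega

/-! ### The program -/

namespace Term

/-- The truth value `true`. -/
abbrev tt : Term := .cons .nil .nil

/-- Negation. -/
abbrev not (s : Term) : Term := .ite s .nil tt

/-- Conjunction. -/
abbrev and (s t : Term) : Term := .ite s t .nil

/-- Disjunction. -/
abbrev or (s t : Term) : Term := .ite s tt t

/-- The `k`-fold tail. -/
abbrev drop : ℕ → Term → Term
  | 0, t => t
  | k + 1, t => .tail (drop k t)

/-- The `k`-th entry of a list. -/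
abbrev get (k : ℕ) (t : Term) : Term := .head (drop k t)

/-- In the recursive case of `foldBody`, the first element of the list. -/
abbrev elt : Term := .head (.head (.var 1))

end Term

open Term

/-- Recursion over two lists of the same length, with `op` applied to their elements. -/
def zipBody (i : ℕ) (op : Term) : Term :=
  foldBody i .nil (drop 2 (.var 0)) (.cons op (.var 0))

/-- The numbers are the positions of the bodies in `prog`, where position 0 is `mainBody`. Lookups
of functions therefore hold by `rfl`. -/
abbrev unionFn : ℕ := 1
abbrev diffFn : ℕ := 2
abbrev interFn : ℕ := 3
abbrev emptyFn : ℕ := 4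
abbrev complFn : ℕ := 5
abbrev zerosFn : ℕ := 6
abbrev truesFn : ℕ := 7
abbrev leFn : ℕ := 8
abbrev mapConsFn : ℕ := 9
abbrev unitsFn : ℕ := 10
abbrev subsetsFn : ℕ := 11
abbrev nbrsFn : ℕ := 12
abbrev iterFn : ℕ := 13
abbrev domFn : ℕ := 14
abbrev minFn : ℕ := 15
abbrev chainFn : ℕ := 16
abbrev nestedFn : ℕ := 17
abbrev findFn : ℕ := 18
abbrev residualFn : ℕ := 19
abbrev enumFn : ℕ := 20
abbrev branchFn : ℕ := 21
abbrev edgeRowFn : ℕ := 22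
abbrev edgesFn : ℕ := 23
abbrev collectFn : ℕ := 24

abbrev unionT (s t : Term) : Term := .call unionFn (.cons s t)
abbrev diffT (s t : Term) : Term := .call diffFn (.cons s t)
abbrev interT (s t : Term) : Term := .call interFn (.cons s t)
abbrev emptyT (s : Term) : Term := .call emptyFn (.cons s .nil)

/-- The test whether `D` is a connected dominating set of the graph `g`. -/
abbrev domT (D g : Term) : Term := .call domFn (.cons (.head g) (.cons D g))

/-- The test whether `D` is a minimal connected dominating set of the graph `g`. -/
abbrev minT (D g : Term) : Term := .call minFn (.cons (.head g) (.cons D g))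

/-- `(S . T) ↦ S ∪ T`. -/
def unionBody : Term := zipBody unionFn (or elt (get 1 (.var 1)))

/-- `(S . T) ↦ S \ T`. -/
def diffBody : Term := zipBody diffFn (and elt (not (get 1 (.var 1))))

/-- `(S . T) ↦ S ∩ T`. -/
def interBody : Term := zipBody interFn (and elt (get 1 (.var 1)))

/-- `(S . _) ↦ S = ∅`. -/
def emptyBody : Term := foldBody emptyFn tt (drop 1 (.var 0)) (and (.var 0) (not elt))

/-- `(S . _) ↦ Sᶜ`. -/
def complBody : Term := foldBody complFn .nil (drop 1 (.var 0)) (.cons (not elt) (.var 0))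

/-- The list of as many `nil`s as the given list has elements. -/
def zerosBody : Term := foldBody zerosFn .nil (drop 1 (.var 0)) (.cons .nil (.var 0))

/-- The cardinality of a set in unary. -/
def truesBody : Term :=
  foldBody truesFn .nil (drop 1 (.var 0)) (.ite elt (.cons .nil (.var 0)) (.var 0))

/-- The comparison of two unary numbers. -/
def leBody : Term := foldBody leFn tt (drop 2 (.var 0)) (and (drop 1 (.var 1)) (.var 0))

/-- `(l . (b . acc)) ↦ l.map (cons b) ++ acc`. -/
def mapConsBody : Term :=
  foldBody mapConsFn (drop 2 (.var 0)) (drop 1 (.var 0))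
    (.cons (.cons (get 1 (.var 1)) elt) (.var 0))

/-- The list of the singletons. -/
def unitsBody : Term :=
  foldBody unitsFn .nil (drop 1 (.var 0))
    (.cons (.cons tt (.call zerosFn (.cons (.tail (.head (.var 1))) .nil)))
      (.call mapConsFn (.cons (.var 0) (.cons .nil .nil))))

/-- The list of the subsets of a set. -/
def subsetsBody : Term :=
  foldBody subsetsFn tt (drop 1 (.var 0))
    (.bind (.call mapConsFn (.cons (.var 0) (.cons .nil .nil)))
      (.ite (.head (.head (.var 2)))
        (.call mapConsFn (.cons (.var 1) (.cons tt (.var 0)))) (.var 0)))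

/-- `(rows . (X . S)) ↦ S ∪ N(X)`. -/
def nbrsBody : Term :=
  foldBody nbrsFn (drop 2 (.var 0)) (.cons (drop 1 (get 1 (.var 0))) (drop 2 (.var 0)))
    (.ite (.head (get 1 (.var 1))) (unionT elt (.var 0)) (.var 0))

/-- `(l . (rows . (D . S))) ↦` the result of iterating `S ↦ S ∪ N(S ∩ D)` as often as `l` is
long. -/
def iterBody : Term :=
  foldBody iterFn (drop 3 (.var 0)) (drop 1 (.var 0))
    (.call nbrsFn (.cons (get 1 (.var 1)) (.cons (interT (.var 0) (get 2 (.var 1))) (.var 0))))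

/-- `(units . (D . (units . (rows . univ)))) ↦ D` is a connected dominating set. -/
def domBody : Term :=
  foldBody domFn .nil (drop 1 (.var 0))
    (or (.var 0) (emptyT (diffT (drop 4 (.var 1))
      (.call iterFn (.cons (get 3 (.var 1)) (.cons (get 3 (.var 1)) (.cons (get 1 (.var 1))
        (interT elt (get 1 (.var 1))))))))))

/-- `(units . (D . graph)) ↦ D` is a minimal connected dominating set. -/
def minBody : Term :=
  foldBody minFn (domT (get 1 (.var 0)) (drop 2 (.var 0))) (drop 1 (.var 0))
    (and (.var 0) (or (emptyT (interT elt (get 1 (.var 1))))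
      (not (domT (diffT (get 1 (.var 1)) elt) (drop 2 (.var 1))))))

/-- `(H . (f . e)) ↦` for all `g ∈ H`, `f ⊆ g` or `g ∩ e ⊆ f`. -/
def chainBody : Term :=
  foldBody chainFn tt (drop 1 (.var 0))
    (and (.var 0) (or (emptyT (diffT (get 1 (.var 1)) elt))
      (emptyT (diffT (interT elt (drop 2 (.var 1))) (get 1 (.var 1))))))

/-- `(F . (e . H)) ↦` for all `f ∈ F` and `g ∈ H`, `f ∩ e ⊆ g` or `g ∩ e ⊆ f`. -/
def nestedBody : Term :=
  foldBody nestedFn tt (drop 1 (.var 0))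
    (and (.var 0) (.call chainFn (.cons (drop 2 (.var 1))
      (.cons (interT elt (get 1 (.var 1))) (get 1 (.var 1))))))

/-- `(F . H) ↦` the first `e` in `F` on which `H` is nested. -/
def findBody : Term :=
  foldBody findFn .nil (drop 1 (.var 0))
    (.ite (.call nestedFn (.cons (drop 1 (.var 1)) (.cons elt (drop 1 (.var 1))))) elt (.var 0))

/-- `(H . (x . e)) ↦` the sets `f \ e` with `f ∈ H` disjoint from `x`. -/
def residualBody : Term :=
  foldBody residualFn .nil (drop 1 (.var 0))
    (.ite (emptyT (interT (get 1 (.var 1)) elt))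
      (.cons (diffT elt (drop 2 (.var 1))) (.var 0)) (.var 0))

/-- `(C . (H . (graph . acc)))`: prepends to `acc` the minimal connected dominating sets among the
unions of `C` and transversals of `H`. -/
def enumBody : Term :=
  .ite (get 1 (.var 0))
    (.bind (.call findFn (.cons (get 1 (.var 0)) (get 1 (.var 0))))
      (.call branchFn (.cons (.head (get 2 (.var 1))) (.cons (.var 0) (.var 1)))))
    (.ite (minT (get 0 (.var 0)) (get 2 (.var 0)))
      (.cons (get 0 (.var 0)) (drop 3 (.var 0))) (drop 3 (.var 0)))

/-- `(units . (e . (C . (H . (graph . acc)))))`: the branches for the elements of `e`. -/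
def branchBody : Term :=
  foldBody branchFn (drop 5 (.var 0)) (drop 1 (.var 0))
    (.ite (emptyT (interT elt (get 1 (.var 1)))) (.var 0)
      (.call enumFn (.cons (unionT (get 2 (.var 1)) elt)
        (.cons (.call residualFn (.cons (get 3 (.var 1)) (.cons elt (get 1 (.var 1)))))
          (.cons (get 4 (.var 1)) (.var 0))))))

/-- `(rows . (r . (A . (D . (graph . acc)))))`: prepends to `acc` the sets `e = A ∩ (r ∩ r')`, for
the rows `r'`, such that `D \ e` is not a connected dominating set. -/
def edgeRowBody : Term :=
  foldBody edgeRowFn (drop 5 (.var 0)) (drop 1 (.var 0))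
    (.bind (interT (get 2 (.var 1)) (interT (get 1 (.var 1)) elt))
      (.ite (domT (diffT (get 3 (.var 2)) (.var 0)) (get 4 (.var 2)))
        (.var 1) (.cons (.var 0) (.var 1))))

/-- `(rows . (A . (D . graph))) ↦` the hyperedges on `A`. -/
def edgesBody : Term :=
  foldBody edgesFn
    (.ite (domT (diffT (get 2 (.var 0)) (get 1 (.var 0))) (drop 3 (.var 0)))
      .nil (.cons (get 1 (.var 0)) .nil))
    (drop 1 (.var 0))
    (.call edgeRowFn (.cons (get 1 (drop 3 (.var 1))) (.cons elt (.cons (get 1 (.var 1))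
      (.cons (get 2 (.var 1)) (.cons (drop 3 (.var 1)) (.var 0)))))))

/-- `(Bs . (A . graph)) ↦` the minimal connected dominating sets `B ∪ T` with `B` in `Bs` and
`T ⊆ A`. -/
def collectBody : Term :=
  foldBody collectFn .nil (drop 1 (.var 0))
    (.bind (unionT elt (get 1 (.var 1)))
      (.ite (domT (.var 0) (drop 2 (.var 2)))
        (.call enumFn (.cons (.head (.head (.var 2)))
          (.cons (.call edgesFn (.cons (get 1 (drop 2 (.var 2)))
            (.cons (get 1 (.var 2)) (.cons (.var 0) (drop 2 (.var 2))))))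
            (.cons (drop 2 (.var 2)) (.var 1)))))
        (.var 1)))

/-- The main function. -/
def mainBody : Term :=
  .bind (.call complFn (.cons (.head (.var 0)) .nil))
    (.bind (.cons (.call unitsFn (.cons (.head (.var 1)) .nil))
        (.cons (.tail (.var 1)) (unionT (.head (.var 1)) (.var 0))))
      (.ite (.call leFn (.cons (.call truesFn (.cons (.head (.var 2)) .nil))
          (.call truesFn (.cons (.var 1) .nil))))
        (.call collectFn (.cons (.call subsetsFn (.cons (.head (.var 2)) .nil))
          (.cons (.var 1) (.var 0))))
        (.call collectFn (.cons (.call subsetsFn (.cons (.var 1) .nil))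
          (.cons (.head (.var 2)) (.var 0))))))

/-- The algorithm. -/
def prog : Program :=
  [mainBody, unionBody, diffBody, interBody, emptyBody, complBody, zerosBody, truesBody, leBody,
    mapConsBody, unitsBody, subsetsBody, nbrsBody, iterBody, domBody, minBody, chainBody,
    nestedBody, findBody, residualBody, enumBody, branchBody, edgeRowBody, edgesBody, collectBody]

/-! ### Sets -/

section Logic

variable {P : Program} {e : List Data} {s t : Term} {p q : Prop} {k l : ℕ} {d d' : Data}

theorem Ev.of_eq (h : Ev P e t d k) (hd : d = d') : Ev P e t d' k := hd ▸ h

theorem ev_tt : Ev P e tt (Data.ofProp True) 3 :=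
  (Ev.of_isPure (t := tt)).of_eq (by simp [Data.ofProp, Term.value])

theorem Ev.not (hs : Ev P e s (Data.ofProp p) k) :
    Ev P e (.not s) (Data.ofProp (¬ p)) (k + (1 + 3) + 1) :=
  Ev.ite hs (fun hp => Ev.of_isPure (t := .nil) (hd := by simp [Data.ofProp, hp, Term.value]))
    (fun hp => ev_tt.of_eq (by simp [hp]))

theorem Ev.and (hs : Ev P e s (Data.ofProp p) k) (ht : p → Ev P e t (Data.ofProp q) l) :
    Ev P e (.and s t) (Data.ofProp (p ∧ q)) (k + (l + 1) + 1) :=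
  Ev.ite hs (fun hp => (ht hp).of_eq (by simp [hp]))
    (fun hp => Ev.of_isPure (t := .nil) (hd := by simp [Data.ofProp, hp, Term.value]))

theorem Ev.or (hs : Ev P e s (Data.ofProp p) k) (ht : ¬ p → Ev P e t (Data.ofProp q) l) :
    Ev P e (.or s t) (Data.ofProp (p ∨ q)) (k + (3 + l) + 1) :=
  Ev.ite hs (fun hp => ev_tt.of_eq (by simp [hp])) (fun hp => (ht hp).of_eq (by simp [hp]))

end Logic

open Data (ofProp ofVertexSet ofFamily ofList)

/-- The characteristic vector of `S` restricted to the vertices in `l`. -/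
noncomputable def vec {n : ℕ} (l : List (Fin n)) (S : Finset (Fin n)) : Data :=
  ofList (l.map fun v => ofProp (v ∈ S))

theorem vec_finRange {n : ℕ} (S : Finset (Fin n)) : vec (List.finRange n) S = ofVertexSet S := by
  rw [vec, ofVertexSet, List.ofFn_eq_map]

/-- The recursion runs over suffixes of the vertex list, so the induction is over the vectors
restricted to an arbitrary list of vertices. -/
theorem ev_zip {i : ℕ} {op : Term} (hi : prog[i]? = some (zipBody i op)) {n N K : ℕ} (hn : n ≤ N)
    {S T Z : Finset (Fin n)}
    (h : ∀ v r l l', Ev prog [r, .cons (.cons (ofProp (v ∈ S)) l) (.cons (ofProp (v ∈ T)) l')] op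
      (ofProp (v ∈ Z)) K) :
    Ev prog [.cons (ofVertexSet S) (ofVertexSet T)] (zipBody i op) (ofVertexSet Z)
      (N * (K + 14) + 4) := by
  have key : ∀ l : List (Fin n),
      Ev prog [.cons (vec l S) (vec l T)] (zipBody i op) (vec l Z) (l.length * (K + 14) + 4) := by
    intro l
    induction l with
    | nil => exact (Ev.fold_nil (Ev.of_isPure (t := .nil))).mono (by simp [Term.cost])
    | cons v l ih =>
      refine (Ev.fold_cons hi (s' := vec l T) (Ev.of_isPure) ih
        (Ev.cons (h v _ _ _) Ev.of_isPure)).mono ?_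
      simp only [Term.cost, List.length_cons]
      ring_nf
      omega
  refine (vec_finRange S ▸ vec_finRange T ▸ vec_finRange Z ▸ key (List.finRange n)).mono ?_
  rw [List.length_finRange]
  gcongr

theorem ev_union : ∃ K, Poly K ∧ ∀ {n N : ℕ}, n ≤ N → ∀ S T : Finset (Fin n),
    Ev prog [.cons (ofVertexSet S) (ofVertexSet T)] unionBody (ofVertexSet (S ∪ T)) (K N) := by
  -- The bound K stays open until the evaluation determines it by unification; only then is it shown
  -- to be polynomial. The parameter N ≥ n leaves room for lists longer than n. The same pattern
  -- recurs below.
  apply Exists.intro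
  apply And.intro
  rotate_left
  · intro n N hn S T
    exact ev_zip rfl hn fun v r l l' =>
      (Ev.or (Ev.of_isPure (d := ofProp (v ∈ S))) fun _ =>
        Ev.of_isPure (d := ofProp (v ∈ T))).of_eq (by simp)
  · fun_prop

theorem ev_diff : ∃ K, Poly K ∧ ∀ {n N : ℕ}, n ≤ N → ∀ S T : Finset (Fin n),
    Ev prog [.cons (ofVertexSet S) (ofVertexSet T)] diffBody (ofVertexSet (S \ T)) (K N) := by
  apply Exists.intro
  apply And.intro
  rotate_left
  · intro n N hn S T
    exact ev_zip rfl hn fun v r l l' =>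
      (Ev.and (Ev.of_isPure (d := ofProp (v ∈ S))) fun _ =>
        Ev.not (Ev.of_isPure (d := ofProp (v ∈ T)))).of_eq (by simp)
  · fun_prop

theorem ev_inter : ∃ K, Poly K ∧ ∀ {n N : ℕ}, n ≤ N → ∀ S T : Finset (Fin n),
    Ev prog [.cons (ofVertexSet S) (ofVertexSet T)] interBody (ofVertexSet (S ∩ T)) (K N) := by
  apply Exists.intro
  apply And.intro
  rotate_left
  · intro n N hn S T
    exact ev_zip rfl hn fun v r l l' =>
      (Ev.and (Ev.of_isPure (d := ofProp (v ∈ S))) fun _ =>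
        Ev.of_isPure (d := ofProp (v ∈ T))).of_eq (by simp)
  · fun_prop

theorem foldr_and_iff {α : Type*} (Q : α → Prop) (p : Prop) (l : List α) :
    l.foldr (fun a r => r ∧ Q a) p ↔ p ∧ ∀ a ∈ l, Q a := by
  induction l with
  | nil => simp
  | cons a l ih => simp [ih]; tauto

theorem foldr_or_iff {α : Type*} (Q : α → Prop) (l : List α) :
    l.foldr (fun a r => r ∨ Q a) False ↔ ∃ a ∈ l, Q a := by
  induction l with
  | nil => simp
  | cons a l ih => simp [ih, or_comm]

theorem ev_empty : ∃ K, Poly K ∧ ∀ {n N : ℕ}, n ≤ N → ∀ S : Finset (Fin n),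
    Ev prog [.cons (ofVertexSet S) .nil] emptyBody (ofProp (S = ∅)) (K N) := by
  apply Exists.intro
  apply And.intro
  rotate_left
  · intro n N hn S
    rw [← vec_finRange]
    exact (Ev.foldr rfl (fun v : Fin n => ofProp (v ∈ S)) ofProp (fun v r => r ∧ ¬ v ∈ S)
      (b₀ := True) ev_tt (List.finRange n) (by simpa using hn)
      (fun v _ p l => Ev.and (Ev.of_isPure (d := ofProp p)) fun _ =>
        Ev.not (Ev.of_isPure (d := ofProp (v ∈ S))))).of_eq (by
          simp [foldr_and_iff, Finset.eq_empty_iff_forall_notMem])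
  · fun_prop

theorem ev_compl : ∃ K, Poly K ∧ ∀ {n N : ℕ}, n ≤ N → ∀ S : Finset (Fin n),
    Ev prog [.cons (ofVertexSet S) .nil] complBody (ofVertexSet Sᶜ) (K N) := by
  apply Exists.intro
  apply And.intro
  rotate_left
  · intro n N hn S
    rw [← vec_finRange S]
    exact (Ev.foldr rfl (fun v : Fin n => ofProp (v ∈ S)) ofList
      (fun v r => ofProp (¬ v ∈ S) :: r)
      (b₀ := []) Ev.of_isPure (List.finRange n) (by simpa using hn)
      (fun v _ p l => Ev.cons (Ev.not (Ev.of_isPure (d := ofProp (v ∈ S))))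
        (Ev.of_isPure (d := ofList p)))).of_eq (by
          simp [List.foldr_cons_eq_append, ← vec_finRange, vec])
  · fun_prop

theorem ev_trues : ∃ K, Poly K ∧ ∀ {n N : ℕ}, n ≤ N → ∀ S : Finset (Fin n),
    Ev prog [.cons (ofVertexSet S) .nil] truesBody (ofList (List.replicate S.card .nil))
      (K N) := by
  classical
  apply Exists.intro
  apply And.intro
  rotate_left
  · intro n N hn S
    rw [← vec_finRange S]
    refine (Ev.foldr rfl (fun v : Fin n => ofProp (v ∈ S))
      (fun k : ℕ => ofList (List.replicate k .nil)) (fun v r => if v ∈ S then r + 1 else r)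
      (b₀ := 0) Ev.of_isPure (List.finRange n) (by simpa using hn)
      (fun v _ p l => Ev.ite (Ev.of_isPure (d := ofProp (v ∈ S)))
        (fun hv => (Ev.cons Ev.of_isPure (Ev.of_isPure (d := ofList (List.replicate p .nil)))).of_eq
          (by simp [hv, List.replicate_succ, ofList, Term.value]))
        (fun hv => (Ev.of_isPure (d := ofList (List.replicate p .nil))).of_eq
          (by simp [hv])))).of_eq ?_
    have : ∀ l : List (Fin n), l.foldr (fun v r => if v ∈ S then r + 1 else r) 0 =
        (l.filter fun v => v ∈ S).length := by
      intro l
      induction l with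
      | nil => rfl
      | cons v l ih => by_cases hv : v ∈ S <;> simp [hv, ih]
    rw [this, ← List.toFinset_card_of_nodup ((List.nodup_finRange n).filter _)]
    congr
    ext v
    simp
  · fun_prop

theorem ev_le : ∃ K, Poly K ∧ ∀ {a b N : ℕ}, a ≤ N →
    Ev prog [.cons (ofList (List.replicate a .nil)) (ofList (List.replicate b .nil))] leBody
      (ofProp (a ≤ b)) (K N) := by
  refine ⟨fun N => N * 30 + 6, by fun_prop, fun {a b N} ha => ?_⟩
  suffices h : ∀ a b, Ev prog [.cons (ofList (List.replicate a .nil))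
      (ofList (List.replicate b .nil))] leBody (ofProp (a ≤ b)) (a * 30 + 6) from
    (h a b).mono (by dsimp only; omega)
  intro a
  induction a with
  | zero => exact fun b => (Ev.fold_nil ev_tt).of_eq (by simp)
  | succ a ih =>
    intro b
    cases b with
    | zero =>
      -- The tail of `nil` is `nil`, so the recursion goes on with b = 0; its result is discarded
      -- because the second list is empty.
      exact (Ev.fold_cons rfl (s' := ofList (List.replicate 0 .nil)) Ev.of_isPure (ih 0)
        (d := ofProp (a + 1 ≤ 0)) ((Ev.ite_nil Ev.of_isPure Ev.of_isPure).of_eq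
          (d := .nil) (by simp [ofProp]))).mono (by simp [Term.cost]; omega)
    | succ b =>
      exact (Ev.fold_cons rfl (s' := ofList (List.replicate b .nil)) Ev.of_isPure (ih b)
        (d := ofProp (a + 1 ≤ b + 1)) ((Ev.ite_cons (b := .nil)
          (d := ofList (List.replicate b .nil)) Ev.of_isPure
          (Ev.of_isPure (d := ofProp (a ≤ b)))).of_eq (by simp))).mono
            (by simp [Term.cost]; omega)

theorem ev_mapCons (b : Data) (l acc : List Data) {N : ℕ} (hl : l.length ≤ N) :
    Ev prog [.cons (ofList l) (.cons b (ofList acc))] mapConsBody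
      (ofList (l.map (fun x => .cons b x) ++ acc)) (N * 30 + 6) := by
  refine ((List.map_id l ▸ Ev.foldr rfl id ofList (fun x r => .cons b x :: r) (b₀ := acc)
    Ev.of_isPure l hl (fun v _ p _ => Ev.cons (Ev.cons (Ev.of_isPure (d := b))
      (Ev.of_isPure (d := v))) (Ev.of_isPure (d := ofList p))) :
      Ev prog [.cons (ofList l) (.cons b (ofList acc))] mapConsBody _ _).of_eq
        (by simp [List.foldr_cons_eq_append])).mono ?_
  simp [Term.cost]
  omega

theorem ev_zeros (l : List Data) {N : ℕ} (hl : l.length ≤ N) :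
    Ev prog [.cons (ofList l) .nil] zerosBody (ofList (List.replicate l.length .nil))
      (N * 30 + 6) := by
  refine ((List.map_id l ▸ Ev.foldr rfl id ofList (fun _ r => .nil :: r) (b₀ := [])
    Ev.of_isPure l hl (fun v _ p _ => Ev.cons Ev.of_isPure (Ev.of_isPure (d := ofList p))) :
      Ev prog [.cons (ofList l) .nil] zerosBody _ _).of_eq
        (by simp [List.foldr_cons_eq_append])).mono ?_
  simp [Term.cost]
  omega

/-- The list of the singletons. -/
noncomputable def unitsData (n : ℕ) : Data :=
  ofList ((List.finRange n).map fun v => ofVertexSet {v})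

theorem ofVertexSet_succ {n : ℕ} (S : Finset (Fin (n + 1))) :
    ofVertexSet S = .cons (ofProp ((0 : Fin (n + 1)) ∈ S))
      (ofList (List.ofFn fun v : Fin n => ofProp (v.succ ∈ S))) := by
  rw [ofVertexSet, List.ofFn_succ, ofList]

theorem unitsData_succ (n : ℕ) : unitsData (n + 1) =
    .cons (.cons (ofProp True) (ofList (List.replicate n .nil)))
      (ofList (((List.finRange n).map fun v => ofVertexSet {v}).map (fun x => .cons .nil x))) := by
  rw [unitsData, List.finRange_succ, List.map_cons, ofList, ofVertexSet_succ, List.map_map,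
    List.map_map]
  congr 1
  · congr 1
    · simp
    · congr 1
      simp [ofProp, List.ofFn_const]
  · congr 2
    funext v
    simp only [Function.comp, ofVertexSet_succ, Finset.mem_singleton]
    congr 1
    · simp [ofProp, (Fin.succ_ne_zero v).symm]
    · simp [ofVertexSet]

theorem ev_units : ∃ K, Poly K ∧ ∀ {N : ℕ} (l : List Data), l.length ≤ N →
    Ev prog [.cons (ofList l) .nil] unitsBody (unitsData l.length) (K N) := by
  refine ⟨fun N => N * (60 * N + 60) + 6, by fun_prop, fun {N} l hl => ?_⟩
  suffices h : Ev prog [.cons (ofList l) .nil] unitsBody (unitsData l.length)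
      (l.length * (60 * N + 60) + 6) from
    h.mono (by dsimp only; gcongr)
  induction l with
  | nil => exact (Ev.fold_nil (Ev.of_isPure (d := unitsData 0))).mono (by simp [Term.cost])
  | cons a l ih =>
    rw [List.length_cons] at hl
    refine ((Ev.fold_cons rfl (s' := .nil) Ev.of_isPure (ih (by omega))
      (Ev.cons (Ev.cons ev_tt (Ev.call rfl (Ev.of_isPure (d := .cons (ofList l) .nil))
        (ev_zeros l (by omega : l.length ≤ N))))
        (Ev.call rfl (Ev.of_isPure (d := .cons (unitsData l.length) (.cons .nil (ofList []))))
          (ev_mapCons .nil _ [] (by simpa using (by omega : l.length ≤ N)))))).of_eq ?_).mono ?_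
    · rw [List.length_cons, unitsData_succ, List.append_nil]
    · simp only [Term.cost, List.length_cons]
      ring_nf
      omega

/-- Only vertices of S double the list, so at each stage it has at most 2^|S| entries, and the n
stages contribute a mere polynomial factor. -/
theorem ev_subsets : ∃ K, Poly K ∧ ∀ {n N : ℕ}, n ≤ N → ∀ S : Finset (Fin n),
    ∃ L : List (Finset (Fin n)), L.Nodup ∧ (∀ B, B ∈ L ↔ B ⊆ S) ∧
      Ev prog [.cons (ofVertexSet S) .nil] subsetsBody (ofFamily L) (2 ^ S.card * K N) := by
  classical
  refine ⟨fun N => N * 160 + 10, by fun_prop, fun {n N} hn S => ?_⟩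
  have hpos : 1 ≤ 2 ^ S.card := Nat.one_le_two_pow
  have key : ∀ l : List (Fin n), l.Nodup → ∃ L : List (Finset (Fin n)), L.Nodup ∧
      (∀ B, B ∈ L ↔ B ⊆ S ∧ ∀ x ∈ B, x ∈ l) ∧
      Ev prog [.cons (vec l S) .nil] subsetsBody (ofList (L.map (vec l)))
        (2 ^ S.card * (l.length * 160 + 10)) := by
    intro l
    induction l with
    | nil =>
      intro _
      refine ⟨[∅], by simp, fun B => ?_, ?_⟩
      · simp only [List.mem_singleton, List.not_mem_nil]
        exact ⟨fun h => by simp [h], fun h => Finset.eq_empty_of_forall_notMem h.2⟩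
      · refine (Ev.fold_nil (Ev.of_isPure (t := tt))).mono ?_
        simp only [Term.cost, List.length_nil]
        omega
    | cons v l ih =>
      intro hl
      rw [List.nodup_cons] at hl
      obtain ⟨L, hnd, hmem, hev⟩ := ih hl.2
      have hlen : (L.map (vec l)).length ≤ 2 ^ S.card := by
        rw [List.length_map, ← List.toFinset_card_of_nodup hnd, ← Finset.card_powerset]
        exact Finset.card_le_card fun B hB => by
          rw [List.mem_toFinset, hmem] at hB
          exact Finset.mem_powerset.2 hB.1
      have hv : ∀ B ∈ L, v ∉ B := fun B hB hvB => hl.1 (((hmem B).1 hB).2 v hvB)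
      refine ⟨if v ∈ S then L.map (insert v) ++ L else L, ?_, ?_, ?_⟩
      · split_ifs
        · refine List.Nodup.append (hnd.map_on fun B hB B' hB' h => ?_) hnd fun B hB hB' => ?_
          · rw [← Finset.erase_insert (hv B hB), h, Finset.erase_insert (hv B' hB')]
          · obtain ⟨B', _, rfl⟩ := List.mem_map.1 hB
            exact hv _ hB' (Finset.mem_insert_self v B')
        · exact hnd
      · intro B
        have hcase : v ∉ B → (B ∈ L ↔ B ⊆ S ∧ ∀ x ∈ B, x ∈ v :: l) := by
          intro hvB
          rw [hmem]
          refine and_congr_right fun _ => forall₂_congr fun x hx => ?_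
          rw [List.mem_cons, or_iff_right]
          rintro rfl
          exact hvB hx
        split_ifs with hvS
        · rw [List.mem_append, List.mem_map]
          by_cases hvB : v ∈ B
          · constructor
            · rintro (⟨B', hB', rfl⟩ | hB)
              · rw [hmem] at hB'
                refine ⟨Finset.insert_subset hvS hB'.1, fun x hx => ?_⟩
                rcases Finset.mem_insert.1 hx with rfl | hx
                · exact List.mem_cons_self
                · exact List.mem_cons_of_mem _ (hB'.2 x hx)
              · exact absurd hvB (hv B hB)
            · rintro ⟨h1, h2⟩
              refine Or.inl ⟨B.erase v, (hmem _).2 ⟨(Finset.erase_subset v B).trans h1,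
                fun x hx => ?_⟩, Finset.insert_erase hvB⟩
              rw [Finset.mem_erase] at hx
              exact (List.mem_cons.1 (h2 x hx.2)).resolve_left hx.1
          · rw [← hcase hvB]
            refine ⟨fun h => h.resolve_left ?_, Or.inr⟩
            rintro ⟨B', _, rfl⟩
            exact hvB (Finset.mem_insert_self v B')
        · by_cases hvB : v ∈ B
          · exact iff_of_false (fun h => hv B h hvB) fun h => hvS (h.1 hvB)
          · exact hcase hvB
      · have h0 : (L.map (vec (v :: l))) = (L.map (vec l)).map (fun x => .cons .nil x) := by
          rw [List.map_map]
          refine List.map_congr_left fun B hB => ?_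
          simp [vec, ofList, ofProp, hv B hB]
        have h1 : ((L.map (insert v)).map (vec (v :: l))) =
            (L.map (vec l)).map (fun x => .cons (ofProp True) x) := by
          rw [List.map_map, List.map_map]
          refine List.map_congr_left fun B hB => ?_
          simp only [vec, ofList, Function.comp, List.map_cons, Finset.mem_insert_self]
          congr 2
          refine List.map_congr_left fun x hx => ?_
          have : x ≠ v := fun h => hl.1 (h ▸ hx)
          simp [Finset.mem_insert, this]
        refine (Ev.fold_cons rfl (s' := .nil) Ev.of_isPure hev
          (Ev.bind (Ev.call rfl (Ev.of_isPure
              (d := .cons (ofList (L.map (vec l))) (.cons .nil (ofList []))))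
            (ev_mapCons .nil _ [] hlen))
          (Ev.ite (Ev.of_isPure (d := ofProp (v ∈ S)))
            (fun hvS => (Ev.call rfl (Ev.cons (a := ofList (L.map (vec l))) Ev.of_isPure
              (Ev.cons ev_tt (Ev.of_isPure (t := .var 0))))
              (ev_mapCons (ofProp True) _ _ hlen)).of_eq ?_)
            (fun hvS => (Ev.of_isPure (t := .var 0)).of_eq ?_)))).mono ?_
        · rw [if_pos hvS, List.map_append, h1, h0, List.append_nil]
        · rw [if_neg hvS, h0]
          simp [Term.value]
        · simp only [Term.cost, List.length_cons]
          ring_nf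
          nlinarith
  obtain ⟨L, hnd, hmem, hev⟩ := key (List.finRange n) (List.nodup_finRange n)
  refine ⟨L, hnd, fun B => by simp [hmem], ?_⟩
  rw [vec_finRange, List.length_finRange] at hev
  refine (hev.of_eq ?_).mono (by dsimp only; gcongr)
  rw [ofFamily]
  congr 2
  funext B
  exact vec_finRange B

/-! ### Connected dominating sets -/

section Graph

variable {n : ℕ} (G : SimpleGraph (Fin n))

/-- The adjacency matrix. -/
noncomputable def rowsData : Data :=
  ofList ((List.finRange n).map fun v => ofVertexSet (commonNbrs G v v))

/-- The representation of the graph within the program. -/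
noncomputable def graphData : Data :=
  .cons (unitsData n) (.cons (rowsData G) (ofVertexSet (Finset.univ : Finset (Fin n))))

/-- `S` together with the neighbours of the vertices in `S ∩ D`. -/
noncomputable def expand (D S : Finset (Fin n)) : Finset (Fin n) :=
  S ∪ (S ∩ D).biUnion fun v => commonNbrs G v v

variable {G}

theorem mem_expand {D S : Finset (Fin n)} {w : Fin n} :
    w ∈ expand G D S ↔ w ∈ S ∨ ∃ v ∈ S, v ∈ D ∧ G.Adj v w := by
  simp [expand, and_assoc]

theorem exists_reachThrough_of_mem_iterate {D S : Finset (Fin n)} (k : ℕ) {w : Fin n}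
    (hw : w ∈ (expand G D)^[k] S) : ∃ s ∈ S, ReachThrough G D s w := by
  induction k generalizing w with
  | zero => exact ⟨w, hw, Relation.ReflTransGen.refl⟩
  | succ k ih =>
    rw [Function.iterate_succ_apply', mem_expand] at hw
    rcases hw with hw | ⟨v, hv, hvD, hvw⟩
    · exact ih hw
    · obtain ⟨s, hs, hsv⟩ := ih hv
      exact ⟨s, hs, Relation.ReflTransGen.tail hsv ⟨hvD, hvw⟩⟩

theorem subset_iterate_expand (D S : Finset (Fin n)) (k : ℕ) : S ⊆ (expand G D)^[k] S := by
  induction k with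
  | zero => exact subset_rfl
  | succ k ih =>
    rw [Function.iterate_succ_apply']
    exact ih.trans Finset.subset_union_left

/-- A round that is not yet stationary adds a vertex, so after n rounds either the process is
stationary or all n vertices are present. -/
theorem expand_iterate_card (D S : Finset (Fin n)) :
    expand G D ((expand G D)^[n] S) = (expand G D)^[n] S := by
  have key : ∀ k, expand G D ((expand G D)^[k] S) = (expand G D)^[k] S ∨
      k ≤ ((expand G D)^[k] S).card := by
    intro k
    induction k with
    | zero => exact Or.inr (Nat.zero_le _)
    | succ k ih =>
      rw [Function.iterate_succ_apply']
      by_cases h : expand G D ((expand G D)^[k] S) = (expand G D)^[k] S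
      · exact Or.inl (by rw [h, h])
      · refine Or.inr (Nat.succ_le_of_lt ((ih.resolve_left h).trans_lt (Finset.card_lt_card ?_)))
        exact Finset.ssubset_iff_subset_ne.2 ⟨Finset.subset_union_left, Ne.symm h⟩
  rcases key n with h | h
  · exact h
  · have : (expand G D)^[n] S = Finset.univ := by
      refine Finset.eq_univ_of_card _ (le_antisymm (Finset.card_le_univ _) ?_)
      simpa using h
    rw [this]
    exact Finset.eq_univ_of_forall fun w => mem_expand.2 (Or.inl (Finset.mem_univ w))

/-- The seed {v} ∩ D encodes v ∈ D: for v outside D it is empty, stays empty, and never becomes the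
whole vertex set. -/
theorem isConnectedDominatingSet_iff_iterate {D : Finset (Fin n)} :
    IsConnectedDominatingSet G D ↔ ∃ v, (expand G D)^[n] ({v} ∩ D) = Finset.univ := by
  rw [isConnectedDominatingSet_iff]
  refine exists_congr fun v => ?_
  constructor
  · rintro ⟨hv, h⟩
    refine Finset.eq_univ_of_forall fun w => ?_
    have := h w
    induction this with
    | refl => exact subset_iterate_expand D _ n (by simp [hv])
    | @tail b c _ hbc ih =>
      rw [← expand_iterate_card]
      exact mem_expand.2 (Or.inr ⟨b, ih, hbc⟩)
  · intro h
    have h' : ∀ w, ∃ s ∈ {v} ∩ D, ReachThrough G D s w := fun w =>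
      exists_reachThrough_of_mem_iterate n (h ▸ Finset.mem_univ w)
    refine ⟨?_, fun w => ?_⟩
    · obtain ⟨s, hs, _⟩ := h' v
      simp only [Finset.mem_inter, Finset.mem_singleton] at hs
      exact hs.1 ▸ hs.2
    · obtain ⟨s, hs, hsw⟩ := h' w
      simp only [Finset.mem_inter, Finset.mem_singleton] at hs
      exact hs.1 ▸ hsw

end Graph

theorem ev_nbrs : ∃ K, Poly K ∧ ∀ {n N : ℕ}, n ≤ N → ∀ (G : SimpleGraph (Fin n))
    (X S : Finset (Fin n)),
    Ev prog [.cons (rowsData G) (.cons (ofVertexSet X) (ofVertexSet S))] nbrsBody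
      (ofVertexSet (S ∪ X.biUnion fun v => commonNbrs G v v)) (K N) := by
  classical
  obtain ⟨K₁, hK₁, h₁⟩ := ev_union
  refine ⟨fun N => N * (K₁ N + 60) + 10, by fun_prop, fun {n N} hn G X S => ?_⟩
  have key : ∀ l : List (Fin n),
      Ev prog [.cons (ofList (l.map fun v => ofVertexSet (commonNbrs G v v)))
        (.cons (vec l X) (ofVertexSet S))] nbrsBody
        (ofVertexSet (l.foldr (fun v r => if v ∈ X then commonNbrs G v v ∪ r else r) S))
        (l.length * (K₁ N + 60) + 10) := by
    intro l
    induction l with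
    | nil => exact (Ev.fold_nil (Ev.of_isPure (d := ofVertexSet S))).mono (by simp [Term.cost])
    | cons v l ih =>
      refine (Ev.fold_cons rfl (s' := .cons (vec l X) (ofVertexSet S)) Ev.of_isPure ih
        (Ev.ite (Ev.of_isPure (d := ofProp (v ∈ X)))
          (fun hv => (Ev.call rfl (Ev.of_isPure (d := .cons (ofVertexSet (commonNbrs G v v))
            (ofVertexSet _))) (h₁ hn _ _)).of_eq (by rw [List.foldr_cons, if_pos hv]))
          (fun hv => (Ev.of_isPure (t := .var 0)).of_eq
            (by rw [List.foldr_cons, if_neg hv]; rfl)))).mono ?_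
      simp only [Term.cost, List.length_cons]
      ring_nf
      omega
  have hk := key (List.finRange n)
  rw [vec_finRange, List.length_finRange] at hk
  refine (hk.of_eq ?_).mono (by dsimp only; gcongr)
  have : ∀ (l : List (Fin n)) w,
      w ∈ l.foldr (fun v r => if v ∈ X then commonNbrs G v v ∪ r else r) S ↔
        w ∈ S ∨ ∃ v ∈ l, v ∈ X ∧ G.Adj v w := by
    intro l w
    induction l with
    | nil => simp
    | cons v l ih => by_cases hv : v ∈ X <;> simp [hv, ih]; tauto
  congr 1
  ext w
  simp [this]

/-- The first copy of the rows serves only as a clock of length n; the second is the adjacency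
matrix. -/
theorem ev_iter : ∃ K, Poly K ∧ ∀ {n N : ℕ}, n ≤ N → ∀ (G : SimpleGraph (Fin n))
    (D S : Finset (Fin n)),
    Ev prog [.cons (rowsData G) (.cons (rowsData G) (.cons (ofVertexSet D) (ofVertexSet S)))]
      iterBody (ofVertexSet ((expand G D)^[n] S)) (K N) := by
  obtain ⟨K₁, hK₁, h₁⟩ := ev_nbrs
  obtain ⟨K₂, hK₂, h₂⟩ := ev_inter
  apply Exists.intro
  apply And.intro
  rotate_left
  · intro n N hn G D S
    exact (Ev.foldr rfl (fun v => ofVertexSet (commonNbrs G v v)) ofVertexSet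
      (fun _ r => expand G D r) (b₀ := S) Ev.of_isPure (List.finRange n) (by simpa using hn)
      (fun v _ T l => Ev.call rfl (Ev.cons (Ev.of_isPure (d := rowsData G))
        (Ev.cons (Ev.call rfl (Ev.of_isPure (d := .cons (ofVertexSet T) (ofVertexSet D)))
          (h₂ hn T D)) (Ev.of_isPure (d := ofVertexSet T)))) (h₁ hn G (T ∩ D) T))).of_eq
            (by simp [List.foldr_const])
  · fun_prop

theorem ev_dom : ∃ K, Poly K ∧ ∀ {n N : ℕ}, n ≤ N → ∀ (G : SimpleGraph (Fin n))
    (D : Finset (Fin n)),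
    Ev prog [.cons (unitsData n) (.cons (ofVertexSet D) (graphData G))]
      domBody (ofProp (IsConnectedDominatingSet G D)) (K N) := by
  obtain ⟨K₁, hK₁, h₁⟩ := ev_iter
  obtain ⟨K₂, hK₂, h₂⟩ := ev_inter
  obtain ⟨K₃, hK₃, h₃⟩ := ev_diff
  obtain ⟨K₄, hK₄, h₄⟩ := ev_empty
  apply Exists.intro
  apply And.intro
  rotate_left
  · intro n N hn G D
    exact (Ev.foldr rfl (fun v => ofVertexSet {v}) ofProp
      (fun v r => r ∨ Finset.univ \ (expand G D)^[n] ({v} ∩ D) = ∅) (b₀ := False)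
      (Ev.of_isPure (t := .nil) (hd := by simp [ofProp, Term.value]))
      (List.finRange n) (by simpa using hn)
      (fun v _ p l => Ev.or (Ev.of_isPure (d := ofProp p)) fun _ =>
        Ev.call rfl (Ev.cons (Ev.call rfl (Ev.cons (Ev.of_isPure (d := ofVertexSet Finset.univ))
          (Ev.call rfl (Ev.cons (Ev.of_isPure (d := rowsData G))
            (Ev.cons (Ev.of_isPure (d := rowsData G))
              (Ev.cons (Ev.of_isPure (d := ofVertexSet D))
                (Ev.call rfl (Ev.of_isPure (d := .cons (ofVertexSet {v}) (ofVertexSet D)))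
                  (h₂ hn {v} D))))) (h₁ hn G D _))) (h₃ hn _ _))
          (Ev.of_isPure (d := .nil))) (h₄ hn _))).of_eq (by
            rw [foldr_or_iff, isConnectedDominatingSet_iff_iterate]
            simp [Finset.sdiff_eq_empty_iff_subset, Finset.univ_subset_iff])
  · fun_prop

theorem ev_min : ∃ K, Poly K ∧ ∀ {n N : ℕ}, n ≤ N → ∀ (G : SimpleGraph (Fin n))
    (D : Finset (Fin n)),
    Ev prog [.cons (unitsData n) (.cons (ofVertexSet D) (graphData G))]
      minBody (ofProp (IsMinimalConnectedDominatingSet G D)) (K N) := by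
  obtain ⟨K₁, hK₁, h₁⟩ := ev_dom
  obtain ⟨K₂, hK₂, h₂⟩ := ev_inter
  obtain ⟨K₃, hK₃, h₃⟩ := ev_diff
  obtain ⟨K₄, hK₄, h₄⟩ := ev_empty
  apply Exists.intro
  apply And.intro
  rotate_left
  · intro n N hn G D
    exact (Ev.foldr rfl (fun v => ofVertexSet {v}) ofProp
      (fun v r => r ∧ ({v} ∩ D = ∅ ∨ ¬ IsConnectedDominatingSet G (D \ {v})))
      (Ev.call rfl (Ev.of_isPure
        (d := .cons (unitsData n) (.cons (ofVertexSet D) (graphData G)))) (h₁ hn G D))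
      (List.finRange n) (by simpa using hn)
      (fun v _ p l => Ev.and (Ev.of_isPure (d := ofProp p)) fun _ =>
        Ev.or (Ev.call rfl (Ev.cons (Ev.call rfl
            (Ev.of_isPure (d := .cons (ofVertexSet {v}) (ofVertexSet D))) (h₂ hn {v} D))
          (Ev.of_isPure (d := .nil))) (h₄ hn _)) fun _ =>
        Ev.not (Ev.call rfl (Ev.cons (Ev.of_isPure (d := unitsData n))
          (Ev.cons (Ev.call rfl (Ev.of_isPure (d := .cons (ofVertexSet D) (ofVertexSet {v})))
            (h₃ hn D {v})) (Ev.of_isPure (d := graphData G)))) (h₁ hn G _)))).of_eq (by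
              rw [foldr_and_iff, isMinimalConnectedDominatingSet_iff]
              simp [Finset.sdiff_singleton_eq_erase, imp_iff_not_or,
                ← Finset.disjoint_iff_inter_eq_empty])
  · fun_prop

/-! ### Hyperedges -/

theorem ev_chain : ∃ K, Poly K ∧ ∀ {n N : ℕ}, n ≤ N → ∀ (H : List (Finset (Fin n))),
    H.length ≤ N → ∀ f e : Finset (Fin n),
    Ev prog [.cons (ofFamily H) (.cons (ofVertexSet f) (ofVertexSet e))] chainBody
      (ofProp (∀ g ∈ H, f ⊆ g ∨ g ∩ e ⊆ f)) (K N) := by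
  obtain ⟨K₂, hK₂, h₂⟩ := ev_inter
  obtain ⟨K₃, hK₃, h₃⟩ := ev_diff
  obtain ⟨K₄, hK₄, h₄⟩ := ev_empty
  apply Exists.intro
  apply And.intro
  rotate_left
  · intro n N hn H hH f e
    exact (Ev.foldr rfl ofVertexSet ofProp (fun g r => r ∧ (f \ g = ∅ ∨ (g ∩ e) \ f = ∅))
      (b₀ := True) ev_tt H hH
      (fun g _ p l => Ev.and (Ev.of_isPure (d := ofProp p)) fun _ =>
        Ev.or (Ev.call rfl (Ev.cons (Ev.call rfl
            (Ev.of_isPure (d := .cons (ofVertexSet f) (ofVertexSet g))) (h₃ hn f g))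
          (Ev.of_isPure (d := .nil))) (h₄ hn _)) fun _ =>
        Ev.call rfl (Ev.cons (Ev.call rfl (Ev.cons (Ev.call rfl
            (Ev.of_isPure (d := .cons (ofVertexSet g) (ofVertexSet e))) (h₂ hn g e))
              (Ev.of_isPure (d := ofVertexSet f))) (h₃ hn _ f))
          (Ev.of_isPure (d := .nil))) (h₄ hn _))).of_eq (by
            rw [foldr_and_iff]
            simp only [true_and, Finset.sdiff_eq_empty_iff_subset])
  · fun_prop

theorem ev_nested : ∃ K, Poly K ∧ ∀ {n N : ℕ}, n ≤ N → ∀ (H : List (Finset (Fin n))),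
    H.length ≤ N → ∀ e : Finset (Fin n),
    Ev prog [.cons (ofFamily H) (.cons (ofVertexSet e) (ofFamily H))] nestedBody
      (ofProp (Nested H e)) (K N) := by
  obtain ⟨K₁, hK₁, h₁⟩ := ev_chain
  obtain ⟨K₂, hK₂, h₂⟩ := ev_inter
  apply Exists.intro
  apply And.intro
  rotate_left
  · intro n N hn H hH e
    exact (Ev.foldr rfl ofVertexSet ofProp
      -- The inclusion g ∩ e ⊆ f ∩ e is equivalent to g ∩ e ⊆ f, so f may be replaced by its trace
      -- on both sides.
      (fun f r => r ∧ (∀ g ∈ H, f ∩ e ⊆ g ∨ g ∩ e ⊆ f ∩ e)) (b₀ := True) ev_tt H hH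
      (fun f _ p l => Ev.and (Ev.of_isPure (d := ofProp p)) fun _ =>
        Ev.call rfl (Ev.cons (Ev.of_isPure (d := ofFamily H)) (Ev.cons (Ev.call rfl
            (Ev.of_isPure (d := .cons (ofVertexSet f) (ofVertexSet e))) (h₂ hn f e))
          (Ev.of_isPure (d := ofVertexSet e)))) (h₁ hn H hH (f ∩ e) e))).of_eq (by
            rw [foldr_and_iff]
            simp only [true_and, Nested, Finset.subset_inter_iff, Finset.inter_subset_right,
              and_true])
  · fun_prop

theorem ev_find : ∃ K, Poly K ∧ ∀ {n N : ℕ}, n ≤ N → ∀ (H : List (Finset (Fin n))),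
    H.length ≤ N → (∃ e ∈ H, Nested H e) → ∃ e ∈ H, Nested H e ∧
    Ev prog [.cons (ofFamily H) (ofFamily H)] findBody (ofVertexSet e) (K N) := by
  classical
  obtain ⟨K₁, hK₁, h₁⟩ := ev_nested
  apply Exists.intro
  apply And.intro
  rotate_left
  · intro n N hn H hH hex
    have key : ∀ l : List (Finset (Fin n)), (∃ e ∈ l, Nested H e) → ∃ e ∈ l, Nested H e ∧
        l.foldr (fun e r => if Nested H e then ofVertexSet e else r) Data.nil =
          ofVertexSet e := by
      intro l
      induction l with
      | nil => simp
      | cons a l ih =>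
        intro h
        by_cases ha : Nested H a
        · exact ⟨a, by simp, ha, by simp [ha]⟩
        · obtain ⟨e, he, hne, hr⟩ := ih (by simpa [ha] using h)
          exact ⟨e, by simp [he], hne, by simpa [ha] using hr⟩
    obtain ⟨e, he, hne, hr⟩ := key H hex
    refine ⟨e, he, hne, ?_⟩
    rw [← hr]
    exact Ev.foldr rfl ofVertexSet id (fun e r => if Nested H e then ofVertexSet e else r)
      (b₀ := Data.nil) Ev.of_isPure H hH
      (fun f _ p l => Ev.ite (Ev.call rfl (Ev.of_isPure
          (d := .cons (ofFamily H) (.cons (ofVertexSet f) (ofFamily H)))) (h₁ hn H hH f))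
        (fun hf => (Ev.of_isPure (d := ofVertexSet f)).of_eq (by rw [if_pos hf]; rfl))
        (fun hf => (Ev.of_isPure (t := .var 0)).of_eq (by rw [if_neg hf]; rfl)))
  · fun_prop

theorem ev_residual : ∃ K, Poly K ∧ ∀ {n N : ℕ}, n ≤ N → ∀ (H : List (Finset (Fin n))),
    H.length ≤ N → ∀ (e : Finset (Fin n)) (x : Fin n),
    Ev prog [.cons (ofFamily H) (.cons (ofVertexSet {x}) (ofVertexSet e))] residualBody
      (ofFamily (residualEdges H e x)) (K N) := by
  classical
  obtain ⟨K₂, hK₂, h₂⟩ := ev_inter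
  obtain ⟨K₃, hK₃, h₃⟩ := ev_diff
  obtain ⟨K₄, hK₄, h₄⟩ := ev_empty
  apply Exists.intro
  apply And.intro
  rotate_left
  · intro n N hn H hH e x
    exact (Ev.foldr rfl ofVertexSet ofFamily
      (fun f r => if x ∈ f then r else (f \ e) :: r) (b₀ := []) Ev.of_isPure H hH
      (fun f _ p l => Ev.ite (Ev.call rfl (Ev.cons (Ev.call rfl
            (Ev.of_isPure (d := .cons (ofVertexSet {x}) (ofVertexSet f))) (h₂ hn {x} f))
          (Ev.of_isPure (d := .nil))) (h₄ hn _))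
        (fun hf => (Ev.cons (Ev.call rfl
            (Ev.of_isPure (d := .cons (ofVertexSet f) (ofVertexSet e))) (h₃ hn f e))
          (Ev.of_isPure (d := ofFamily p))).of_eq (by
            rw [← Finset.disjoint_iff_inter_eq_empty, Finset.disjoint_singleton_left] at hf
            rw [if_neg hf]; rfl))
        (fun hf => (Ev.of_isPure (d := ofFamily p)).of_eq (by
            rw [← Finset.disjoint_iff_inter_eq_empty, Finset.disjoint_singleton_left,
              not_not] at hf
            rw [if_pos hf])))).of_eq (by
        congr 1
        clear hH
        induction H with
        | nil => rfl
        | cons f H ih => by_cases hf : x ∈ f <;> simp [residualEdges, hf, ih])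
  · fun_prop

theorem foldr_ite_cons_eq {α β : Type*} (p : α → Prop) [DecidablePred p] (f : α → β) (l : List α)
    (L : List β) : l.foldr (fun a r => if p a then r else f a :: r) L =
      (l.filter fun a => ¬ p a).map f ++ L := by
  induction l with
  | nil => rfl
  | cons a l ih => by_cases ha : p a <;> simp [ha, ih]

theorem foldr_append_eq {α β : Type*} (f : α → List β) (l : List α) (L : List β) :
    l.foldr (fun a r => f a ++ r) L = l.flatMap f ++ L := by
  induction l with
  | nil => rfl
  | cons a l ih => simp [ih]

open Classical in
/-- The sets `A ∩ (N(x) ∩ N(y))`, for all `y`, that every connected dominating set within `D`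
has to hit. -/
noncomputable def edgeRow {n : ℕ} (G : SimpleGraph (Fin n)) (A D : Finset (Fin n)) (x : Fin n) :
    List (Finset (Fin n)) :=
  ((List.finRange n).filter fun y => ¬ IsConnectedDominatingSet G
    (D \ (A ∩ (commonNbrs G x x ∩ commonNbrs G y y)))).map
      fun y => A ∩ (commonNbrs G x x ∩ commonNbrs G y y)

theorem ev_edgeRow : ∃ K, Poly K ∧ ∀ {n N : ℕ}, n ≤ N → ∀ (G : SimpleGraph (Fin n))
    (A D : Finset (Fin n)) (x : Fin n) (acc : List (Finset (Fin n))),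
    Ev prog [.cons (rowsData G) (.cons (ofVertexSet (commonNbrs G x x)) (.cons (ofVertexSet A)
      (.cons (ofVertexSet D) (.cons (graphData G) (ofFamily acc)))))] edgeRowBody
      (ofFamily (edgeRow G A D x ++ acc)) (K N) := by
  classical
  obtain ⟨K₁, hK₁, h₁⟩ := ev_dom
  obtain ⟨K₂, hK₂, h₂⟩ := ev_inter
  obtain ⟨K₃, hK₃, h₃⟩ := ev_diff
  apply Exists.intro
  apply And.intro
  rotate_left
  · intro n N hn G A D x acc
    rw [edgeRow, ← foldr_ite_cons_eq]
    exact Ev.foldr rfl (fun y => ofVertexSet (commonNbrs G y y)) ofFamily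
      (fun y r => if IsConnectedDominatingSet G
        (D \ (A ∩ (commonNbrs G x x ∩ commonNbrs G y y))) then r else
          (A ∩ (commonNbrs G x x ∩ commonNbrs G y y)) :: r) (b₀ := acc)
      (Ev.of_isPure (d := ofFamily acc)) (List.finRange n) (by simpa using hn)
      (fun y _ L l => Ev.bind
        (Ev.call rfl (Ev.cons (Ev.of_isPure (d := ofVertexSet A)) (Ev.call rfl
          (Ev.of_isPure (d := .cons (ofVertexSet (commonNbrs G x x))
            (ofVertexSet (commonNbrs G y y)))) (h₂ hn _ _))) (h₂ hn _ _))
        (Ev.ite (Ev.call rfl (Ev.cons (Ev.of_isPure (d := unitsData n)) (Ev.cons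
            (Ev.call rfl (Ev.of_isPure (d := .cons (ofVertexSet D) (ofVertexSet
              (A ∩ (commonNbrs G x x ∩ commonNbrs G y y))))) (h₃ hn _ _))
            (Ev.of_isPure (d := graphData G)))) (h₁ hn G _))
          (fun h => (Ev.of_isPure (d := ofFamily L)).of_eq (by rw [if_pos h]))
          (fun h => (Ev.of_isPure (d := .cons (ofVertexSet
            (A ∩ (commonNbrs G x x ∩ commonNbrs G y y))) (ofFamily L))).of_eq
              (by rw [if_neg h]; rfl))))
  · fun_prop

/-- The n * n pairs of rows and the set A itself give at most n * n + 1 hyperedges. All vertices x,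
y are allowed; pairs outside S × S will turn out to be filtered out. -/
theorem ev_edges : ∃ K, Poly K ∧ ∀ {n N : ℕ}, n ≤ N → ∀ (G : SimpleGraph (Fin n))
    (A D : Finset (Fin n)), ∃ H : List (Finset (Fin n)), H.length ≤ n * n + 1 ∧
    (∀ f, f ∈ H ↔ ¬ IsConnectedDominatingSet G (D \ f) ∧
      (f = A ∨ ∃ x y, f = A ∩ (commonNbrs G x x ∩ commonNbrs G y y))) ∧
    Ev prog [.cons (rowsData G) (.cons (ofVertexSet A) (.cons (ofVertexSet D) (graphData G)))]
      edgesBody (ofFamily H) (K N) := by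
  classical
  obtain ⟨K₁, hK₁, h₁⟩ := ev_dom
  obtain ⟨K₂, hK₂, h₂⟩ := ev_edgeRow
  obtain ⟨K₃, hK₃, h₃⟩ := ev_diff
  apply Exists.intro
  apply And.intro
  rotate_left
  · intro n N hn G A D
    let L₀ : List (Finset (Fin n)) := if IsConnectedDominatingSet G (D \ A) then [] else [A]
    refine ⟨(List.finRange n).flatMap (edgeRow G A D) ++ L₀, ?_, ?_, ?_⟩
    · have h0 : L₀.length ≤ 1 := by
        dsimp only [L₀]
        split_ifs <;> simp
      have h1 : ((List.finRange n).flatMap (edgeRow G A D)).length ≤ n * n := by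
        rw [List.length_flatMap]
        refine (List.sum_le_card_nsmul _ n ?_).trans (by simp)
        simp only [List.mem_map, forall_exists_index, and_imp]
        rintro _ x _ rfl
        rw [edgeRow, List.length_map]
        exact (List.length_filter_le _ _).trans (by simp)
      rw [List.length_append]
      omega
    · intro f
      have h0 : f ∈ L₀ ↔ ¬ IsConnectedDominatingSet G (D \ f) ∧ f = A := by
        dsimp only [L₀]
        split_ifs with h
        · simp only [List.not_mem_nil, false_iff, not_and]
          rintro h1 rfl
          exact h1 h
        · rw [List.mem_singleton]
          exact ⟨fun hf => ⟨hf ▸ h, hf⟩, And.right⟩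
      rw [List.mem_append, h0, and_or_left, or_comm]
      refine or_congr Iff.rfl ?_
      simp only [List.mem_flatMap, List.mem_finRange, true_and, edgeRow, List.mem_map,
        List.mem_filter, decide_eq_true_eq]
      constructor
      · rintro ⟨x, y, hc, rfl⟩
        exact ⟨hc, x, y, rfl⟩
      · rintro ⟨hc, x, y, rfl⟩
        exact ⟨x, y, hc, rfl⟩
    · rw [← foldr_append_eq]
      exact Ev.foldr rfl (fun y => ofVertexSet (commonNbrs G y y)) ofFamily
        (fun x r => edgeRow G A D x ++ r) (b₀ := L₀)
        (Ev.ite (Ev.call rfl (Ev.cons (Ev.of_isPure (d := unitsData n)) (Ev.cons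
            (Ev.call rfl (Ev.of_isPure (d := .cons (ofVertexSet D) (ofVertexSet A)))
              (h₃ hn _ _))
            (Ev.of_isPure (d := graphData G)))) (h₁ hn G _))
          (fun h => (Ev.of_isPure (t := .nil)).of_eq (by dsimp only [L₀]; rw [if_pos h]; rfl))
          (fun h => (Ev.of_isPure (d := ofFamily [A])).of_eq
            (by dsimp only [L₀]; rw [if_neg h])))
        (List.finRange n) (by simpa using hn)
        (fun x _ L l => Ev.call rfl (Ev.of_isPure (d := .cons (rowsData G)
          (.cons (ofVertexSet (commonNbrs G x x)) (.cons (ofVertexSet A)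
            (.cons (ofVertexSet D) (.cons (graphData G) (ofFamily L))))))) (h₂ hn G A D x L))
  · fun_prop

/-! ### The enumeration of transversals -/

/-- The bound for the cost of the enumeration of the minimal transversals on `r` points. -/
noncomputable def branchBound (q r : ℕ) : ℕ := ⌊(q : ℝ) * (r + 1) * 1.45 ^ r⌋₊

/-- This determines the base: s^(1/s) over the integers is largest at s = 3, and 3^(1/3) is slightly
below 1.45. -/
theorem le_pow_self (s : ℕ) : (s : ℝ) ≤ 1.45 ^ s := by
  rcases lt_or_ge s 4 with hs | hs
  · interval_cases s <;> norm_num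
  · induction s, hs using Nat.le_induction with
    | base => norm_num
    | succ s hs ih =>
      have : (4 : ℝ) ≤ s := by exact_mod_cast hs
      rw [pow_succ]
      push_cast
      linarith

/-- The recursion for a node with s children, each on r - s points, and local cost q. Since s ·
1.45^(r - s) ≤ 1.45^r, the exponential part is preserved, and the factor r + 1 drops by at least one
per level for s > 0, which pays for q. -/
theorem branchBound_step (q r s : ℕ) (hs : s ≤ r) :
    q + s * branchBound q (r - s) ≤ branchBound q r := by
  refine Nat.le_floor ?_
  have h1 : (1 : ℝ) ≤ 1.45 ^ r := one_le_pow₀ (by norm_num)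
  have hq : (0 : ℝ) ≤ q := Nat.cast_nonneg q
  have hf : (branchBound q (r - s) : ℝ) ≤ q * ((r - s : ℕ) + 1) * 1.45 ^ (r - s) :=
    Nat.floor_le (by positivity)
  push_cast
  rcases Nat.eq_zero_or_pos s with rfl | hs0
  · have hr : (0 : ℝ) ≤ r := Nat.cast_nonneg r
    have : (q : ℝ) * 1 ≤ q * ((r + 1) * 1.45 ^ r) :=
      mul_le_mul_of_nonneg_left (by nlinarith) hq
    simpa [mul_assoc] using this
  · have h2 : (s : ℝ) * 1.45 ^ (r - s) ≤ 1.45 ^ r := by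
      calc (s : ℝ) * 1.45 ^ (r - s) ≤ 1.45 ^ s * 1.45 ^ (r - s) := by
            gcongr
            exact le_pow_self s
        _ = 1.45 ^ r := by rw [← pow_add]; congr 1; omega
    have h3 : (((r - s : ℕ) : ℝ) + 1) ≤ r := by
      have : r - s + 1 ≤ r := by omega
      exact_mod_cast this
    calc (q : ℝ) + s * branchBound q (r - s)
        ≤ q + s * (q * ((r - s : ℕ) + 1) * 1.45 ^ (r - s)) := by gcongr
      _ = q + q * ((r - s : ℕ) + 1) * (s * 1.45 ^ (r - s)) := by ring
      _ ≤ q * 1.45 ^ r + q * r * 1.45 ^ r := by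
          gcongr
          exact le_mul_of_one_le_right hq h1
      _ = q * (r + 1) * 1.45 ^ r := by ring

theorem le_branchBound (q r : ℕ) : q ≤ branchBound q r := by
  simpa using branchBound_step q r 0 (Nat.zero_le r)

/-- C collects the vertices chosen so far and R is the ground set still available. The leaves test
minimality, so spurious transversals do no harm and only completeness for minimal ones is required.
Threading `acc` through avoids the cost of appending lists. -/
theorem ev_enum : ∃ q, Poly q ∧ ∀ {n N : ℕ}, n ≤ N → ∀ (G : SimpleGraph (Fin n))
    {S A : Finset (Fin n)}, HasNested G S A → ∀ (r : ℕ) (R C : Finset (Fin n))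
    (H : List (Finset (Fin n))), R.card = r → H.length ≤ N →
    (∀ f ∈ H, ∃ e, Cand G S A e ∧ f = e ∩ R) → Disjoint C R →
    ∃ L : List (Finset (Fin n)), L.Nodup ∧
      (∀ D ∈ L, IsMinimalConnectedDominatingSet G D ∧ C ⊆ D ∧ D ⊆ C ∪ R) ∧
      (∀ T, IsMinimalTransversal H T → IsMinimalConnectedDominatingSet G (C ∪ T) →
        C ∪ T ∈ L) ∧
      ∀ acc : List (Finset (Fin n)),
        Ev prog [.cons (ofVertexSet C) (.cons (ofFamily H) (.cons (graphData G) (ofFamily acc)))]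
          enumBody (ofFamily (L ++ acc)) (branchBound (q N) r) := by
  classical
  obtain ⟨K₁, hK₁, h₁⟩ := ev_min
  obtain ⟨K₂, hK₂, h₂⟩ := ev_inter
  obtain ⟨K₃, hK₃, h₃⟩ := ev_find
  obtain ⟨K₄, hK₄, h₄⟩ := ev_empty
  obtain ⟨K₅, hK₅, h₅⟩ := ev_residual
  obtain ⟨K₆, hK₆, h₆⟩ := ev_union
  refine ⟨fun N => K₁ N + K₃ N + N * (K₂ N + K₄ N + K₅ N + K₆ N + 200) + 200, by fun_prop, ?_⟩
  intro n N hn G S A hnest r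
  induction r using Nat.strong_induction_on with
  | _ r ih =>
  intro R C H hR hH hcand hCR
  set q := K₁ N + K₃ N + N * (K₂ N + K₄ N + K₅ N + K₆ N + 200) + 200 with hq
  cases H with
  | nil =>
    refine ⟨if IsMinimalConnectedDominatingSet G C then [C] else [], ?_, ?_, ?_, fun acc => ?_⟩
    · split_ifs <;> simp
    · intro D hD
      split_ifs at hD with h
      · rw [List.mem_singleton] at hD
        subst hD
        exact ⟨h, subset_rfl, Finset.subset_union_left⟩
      · simp at hD
    · intro T hT h
      rw [hT.eq_empty, Finset.union_empty] at h ⊢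
      simp [h]
    · refine (Ev.ite_nil Ev.of_isPure (Ev.ite (Ev.call rfl (Ev.of_isPure
        (d := .cons (unitsData n) (.cons (ofVertexSet C) (graphData G)))) (h₁ hn G C))
          (fun h => (Ev.of_isPure (d := .cons (ofVertexSet C) (ofFamily acc))).of_eq
            (by rw [if_pos h]; rfl))
          (fun h => (Ev.of_isPure (d := ofFamily acc)).of_eq
            (by rw [if_neg h]; rfl)))).mono ?_
      refine le_trans ?_ (le_branchBound q r)
      simp only [Term.cost, hq]
      omega
  | cons f₀ H₀ =>
    obtain ⟨e, heH, hne, hfind⟩ := h₃ hn (f₀ :: H₀) hH (hnest R _ (by simp) hcand)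
    have hfR : ∀ f ∈ f₀ :: H₀, f ⊆ R := by
      intro f hf
      obtain ⟨e', _, rfl⟩ := hcand f hf
      exact Finset.inter_subset_right
    generalize hHdef : f₀ :: H₀ = H at *
    have heR := hfR e heH
    -- The condition v ∈ e is placed inside the existential so that `choose` yields a list for every
    -- vertex.
    have hchild : ∀ v, ∃ L : List (Finset (Fin n)), v ∈ e → L.Nodup ∧
        (∀ D ∈ L, IsMinimalConnectedDominatingSet G D ∧ C ∪ {v} ⊆ D ∧
          D ⊆ C ∪ {v} ∪ (R \ e)) ∧
        (∀ T, IsMinimalTransversal (residualEdges H e v) T →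
          IsMinimalConnectedDominatingSet G (C ∪ {v} ∪ T) → C ∪ {v} ∪ T ∈ L) ∧
        ∀ acc : List (Finset (Fin n)),
          Ev prog [.cons (ofVertexSet (C ∪ {v})) (.cons (ofFamily (residualEdges H e v))
            (.cons (graphData G) (ofFamily acc)))]
            enumBody (ofFamily (L ++ acc)) (branchBound q (r - e.card)) := by
      intro v
      by_cases hv : v ∈ e
      -- A branch exists only if e is nonempty, so the ground set R \ e is strictly smaller.
      · have hpos : 0 < e.card := Finset.card_pos.2 ⟨v, hv⟩
        have hle : e.card ≤ r := hR ▸ Finset.card_le_card heR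
        obtain ⟨L, hL⟩ := ih (r - e.card) (by omega) (R \ e) (C ∪ {v}) (residualEdges H e v)
          (by rw [Finset.card_sdiff_of_subset heR, hR])
          (by
            rw [residualEdges, List.length_map]
            exact (List.length_filter_le _ _).trans hH)
          (by
            intro f hf
            simp only [residualEdges, List.mem_map, List.mem_filter] at hf
            obtain ⟨f', ⟨hf', _⟩, rfl⟩ := hf
            obtain ⟨e', he', rfl⟩ := hcand f' hf'
            exact ⟨e', he', Finset.inter_sdiff_assoc _ _ _⟩)
          (by
            rw [Finset.disjoint_union_left, Finset.disjoint_singleton_left]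
            exact ⟨hCR.mono_right Finset.sdiff_subset, by simp [hv]⟩)
        exact ⟨L, fun _ => hL⟩
      · exact ⟨[], fun h => absurd h hv⟩
    choose Lc hLc using hchild
    let F : Fin n → List (Finset (Fin n)) := fun v => if v ∈ e then Lc v else []
    have hF : ∀ v D, D ∈ F v → v ∈ e ∧ D ∈ Lc v := by
      intro v D hD
      dsimp only [F] at hD
      split_ifs at hD with hv
      · exact ⟨hv, hD⟩
      · simp at hD
    refine ⟨(List.finRange n).flatMap F, ?_, ?_, ?_, fun acc => ?_⟩
    · rw [List.nodup_flatMap]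
      refine ⟨fun v _ => ?_, (List.nodup_finRange n).imp fun {v w} hvw => ?_⟩
      · dsimp only [F]
        split_ifs with hv
        · exact (hLc v hv).1
        · exact List.nodup_nil
      · intro D hDv hDw
        obtain ⟨hv, hDv⟩ := hF v D hDv
        obtain ⟨hw, hDw⟩ := hF w D hDw
        -- Branches are disjoint: a set from the branch of v contains v, whereas sets from the
        -- branch of w contain no vertex of e other than w.
        have h1 := ((hLc v hv).2.1 D hDv).2.1
          (Finset.mem_union_right C (Finset.mem_singleton_self v))
        have h2 := ((hLc w hw).2.1 D hDw).2.2 h1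
        simp only [Finset.mem_union, Finset.mem_singleton, Finset.mem_sdiff, hv, not_true,
          and_false, or_false] at h2
        rcases h2 with h2 | h2
        · exact Finset.disjoint_left.1 hCR h2 (heR hv)
        · exact hvw h2
    · intro D hD
      obtain ⟨v, _, hDv⟩ := List.mem_flatMap.1 hD
      obtain ⟨hv, hDv⟩ := hF v D hDv
      obtain ⟨hmin, hsub, hsup⟩ := (hLc v hv).2.1 D hDv
      refine ⟨hmin, Finset.subset_union_left.trans hsub, hsup.trans ?_⟩
      refine Finset.union_subset (Finset.union_subset Finset.subset_union_left ?_)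
        (Finset.sdiff_subset.trans Finset.subset_union_right)
      rw [Finset.singleton_subset_iff]
      exact Finset.mem_union_right C (heR hv)
    · intro T hT hmin
      obtain ⟨x, hxe, hxT, hres⟩ := hT.exists_residual heH hne
      have hCT : C ∪ {x} ∪ T.erase x = C ∪ T := by
        rw [Finset.union_assoc, Finset.singleton_union, Finset.insert_erase hxT]
      refine List.mem_flatMap.2 ⟨x, List.mem_finRange x, ?_⟩
      have := (hLc x hxe).2.2.1 (T.erase x) hres (hCT ▸ hmin)
      dsimp only [F]
      rwa [if_pos hxe, ← hCT]
    · have hbranch : Ev prog [.cons (unitsData n) (.cons (ofVertexSet e) (.cons (ofVertexSet C)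
          (.cons (ofFamily H) (.cons (graphData G) (ofFamily acc)))))] branchBody
          (ofFamily ((List.finRange n).flatMap F ++ acc))
          (20 + ((List.finRange n).map fun v => K₂ N + K₄ N + K₅ N + K₆ N + 100 +
            (if v ∈ e then branchBound q (r - e.card) else 0) + 11).sum + 3) := by
        rw [← foldr_append_eq]
        refine Ev.foldr_sum rfl (fun v => ofVertexSet {v}) ofFamily (fun v r => F v ++ r)
          (K₀ := 20) (b₀ := acc) (K₁ := fun v => K₂ N + K₄ N + K₅ N + K₆ N + 100 +
            if v ∈ e then branchBound q (r - e.card) else 0)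
          ((Ev.of_isPure (d := ofFamily acc)).mono (by simp [Term.cost]))
          (List.finRange n) fun v _ L l => ?_
        refine (Ev.ite (m := K₅ N + K₆ N + 60 +
            if v ∈ e then branchBound q (r - e.card) else 0)
          (Ev.call rfl (Ev.cons (Ev.call rfl
            (Ev.of_isPure (d := .cons (ofVertexSet {v}) (ofVertexSet e))) (h₂ hn {v} e))
          (Ev.of_isPure (d := .nil))) (h₄ hn _)) (fun hv => ?_) (fun hv => ?_)
            : Ev _ _ _ _ (_ + (1 + _) + 1)).mono ?_
        · rw [← Finset.disjoint_iff_inter_eq_empty, Finset.disjoint_singleton_left] at hv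
          exact (Ev.of_isPure (d := ofFamily L)).of_eq (by dsimp only [F]; rw [if_neg hv]; rfl)
        · rw [← Finset.disjoint_iff_inter_eq_empty, Finset.disjoint_singleton_left,
            not_not] at hv
          refine ((Ev.call rfl (Ev.cons (Ev.call rfl (Ev.of_isPure
            (d := .cons (ofVertexSet C) (ofVertexSet {v}))) (h₆ hn C {v}))
            (Ev.cons (Ev.call rfl (Ev.of_isPure (d := .cons (ofFamily H)
              (.cons (ofVertexSet {v}) (ofVertexSet e)))) (h₅ hn H hH e v))
              (Ev.of_isPure (d := .cons (graphData G) (ofFamily L)))))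
              ((hLc v hv).2.2.2 L)).of_eq (by dsimp only [F]; rw [if_pos hv])).mono ?_
          simp only [Term.cost, if_pos hv]
          omega
        · simp only [Term.cost]
          omega
      subst hHdef
      refine (Ev.ite_cons (b := ofVertexSet f₀) (d := ofFamily H₀) Ev.of_isPure (Ev.bind
        (Ev.call rfl (Ev.of_isPure (d := .cons (ofFamily (f₀ :: H₀)) (ofFamily (f₀ :: H₀))))
          hfind)
        (Ev.call rfl (Ev.of_isPure (d := .cons (unitsData n) (.cons (ofVertexSet e)
          (.cons (ofVertexSet C) (.cons (ofFamily (f₀ :: H₀))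
            (.cons (graphData G) (ofFamily acc))))))) hbranch))).mono ?_
      refine le_trans ?_ (branchBound_step q r e.card (hR ▸ Finset.card_le_card heR))
      -- The scan over all n vertices costs a polynomial, and only the |e| elements of e start a
      -- recursive call.
      have hsum : ((List.finRange n).map fun v => K₂ N + K₄ N + K₅ N + K₆ N + 100 +
          (if v ∈ e then branchBound q (r - e.card) else 0) + 11).sum =
          n * (K₂ N + K₄ N + K₅ N + K₆ N + 111) + e.card * branchBound q (r - e.card) := by
        rw [← Fin.sum_univ_def, Finset.sum_add_distrib, Finset.sum_add_distrib]
        simp only [Finset.sum_const, Finset.card_univ, Fintype.card_fin, smul_eq_mul,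
          Finset.sum_ite_mem, Finset.univ_inter]
        ring
      rw [hsum]
      have hnN : n * (K₂ N + K₄ N + K₅ N + K₆ N + 111) ≤
          N * (K₂ N + K₄ N + K₅ N + K₆ N + 200) := Nat.mul_le_mul hn (by omega)
      simp only [Term.cost]
      omega

/-! ### The whole algorithm -/

/-- If D avoided a hyperedge f, then (B ∪ A) \ f would contain D and succeed. If x is removed from
D, the rest fails, so `Rich` supplies a hyperedge missed by the other vertices of T; as T hits it,
it is a private edge of x. -/
theorem isMinimalTransversal_of_isMinimal {n : ℕ} {G : SimpleGraph (Fin n)}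
    {S A D : Finset (Fin n)} (hs : Sides G S A) (hrich : Rich G S A)
    (hD : IsMinimalConnectedDominatingSet G D) {H : List (Finset (Fin n))}
    (hH : ∀ f, f ∈ H ↔ ¬ IsConnectedDominatingSet G ((D ∩ S ∪ A) \ f) ∧
      (f = A ∨ ∃ x y, f = A ∩ (commonNbrs G x x ∩ commonNbrs G y y))) :
    IsMinimalTransversal H (D ∩ A) := by
  have hSA : ∀ {v}, v ∈ S → v ∉ A := fun h1 h2 => Finset.disjoint_left.1 hs.disj h1 h2
  have hDe : D ∩ S ∪ D ∩ A = D := by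
    ext v
    have := hs.cover v
    simp only [Finset.mem_union, Finset.mem_inter]
    tauto
  have hhit : ∀ f ∈ H, ¬ Disjoint f (D ∩ A) := by
    intro f hf hdis
    obtain ⟨h1, h2⟩ := (hH f).1 hf
    have hfA : f ⊆ A := by
      rcases h2 with rfl | ⟨x, y, rfl⟩
      · exact subset_rfl
      · exact Finset.inter_subset_left
    refine h1 (hD.prop.mono fun v hv => ?_)
    rw [Finset.mem_sdiff]
    rcases hs.cover v with h | h
    · exact ⟨Finset.mem_union_left _ (Finset.mem_inter.2 ⟨hv, h⟩), fun hvf => hSA h (hfA hvf)⟩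
    · exact ⟨Finset.mem_union_right _ h, fun hvf =>
        Finset.disjoint_left.1 hdis hvf (Finset.mem_inter.2 ⟨hv, h⟩)⟩
  refine ⟨hhit, fun x hx => ?_⟩
  have hx' := Finset.mem_inter.1 hx
  have herase : D ∩ S ∪ (D ∩ A).erase x = D.erase x := by
    rw [← Finset.erase_eq_of_notMem (s := D ∩ S) (a := x)
      (fun h => hSA (Finset.mem_inter.1 h).2 hx'.2), ← Finset.erase_union_distrib, hDe]
  obtain ⟨e, he, hdis, hce⟩ := hrich (D ∩ S) Finset.inter_subset_right ((D ∩ A).erase x)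
    ((Finset.erase_subset _ _).trans Finset.inter_subset_right)
    (hD.prop.mono (by
      conv_lhs => rw [← hDe]
      exact Finset.union_subset_union_right Finset.inter_subset_right))
    (by
      rw [herase]
      exact (isMinimalConnectedDominatingSet_iff.1 hD).2 x hx'.1)
  have heH : e ∈ H := by
    refine (hH e).2 ⟨hce, ?_⟩
    rcases he with rfl | ⟨y, hy, z, hz, rfl⟩
    · exact Or.inl rfl
    · refine Or.inr ⟨y, z, ?_⟩
      ext w
      simp only [mem_commonNbrs, Finset.mem_inter, and_self]
      exact ⟨fun h => ⟨hs.adj_left h.1 hy, h⟩, And.right⟩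
  refine ⟨e, heH, ?_⟩
  obtain ⟨z, hze, hzT⟩ := Finset.not_disjoint_iff.1 (hhit e heH)
  have hall : ∀ w ∈ e, w ∈ D ∩ A → w = x := by
    intro w hw hwT
    by_contra hwx
    exact Finset.disjoint_left.1 hdis hw (Finset.mem_erase.2 ⟨hwx, hwT⟩)
  refine Finset.eq_singleton_iff_unique_mem.2 ⟨?_, fun w hw => ?_⟩
  · have := hall z hze hzT
    subst this
    exact Finset.mem_inter.2 ⟨hze, hzT⟩
  · rw [Finset.mem_inter] at hw
    exact hall w hw.1 hw.2

/-- The output is the disjoint union over B ⊆ S of the sets D with D ∩ S = B. If B ∪ A fails, no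
such D exists, by monotonicity. -/
theorem ev_collect : ∃ K q, Poly K ∧ Poly q ∧ ∀ {n : ℕ} (G : SimpleGraph (Fin n))
    {S A : Finset (Fin n)}, Sides G S A → HasNested G S A → Rich G S A →
    ∀ Bs : List (Finset (Fin n)), Bs.Nodup → (∀ B, B ∈ Bs ↔ B ⊆ S) →
    ∃ L : List (Finset (Fin n)), L.Nodup ∧
      (∀ D, D ∈ L ↔ IsMinimalConnectedDominatingSet G D) ∧
      Ev prog [.cons (ofFamily Bs) (.cons (ofVertexSet A) (graphData G))] collectBody
        (ofFamily L) (2 ^ S.card * (K n + branchBound (q n) A.card)) := by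
  classical
  obtain ⟨K₁, hK₁, h₁⟩ := ev_dom
  obtain ⟨K₂, hK₂, h₂⟩ := ev_union
  obtain ⟨K₃, hK₃, h₃⟩ := ev_edges
  obtain ⟨q, hq, h₄⟩ := ev_enum
  -- This value bounds both the number n of vertices and the number n * n + 1 of hyperedges.
  have hM : Poly fun n => n * n + n + 1 := by fun_prop
  refine ⟨fun n => K₁ n + K₂ n + K₃ n + 200, fun n => q (n * n + n + 1), by fun_prop,
    hq.comp hM, ?_⟩
  intro n G S A hs hnest hrich Bs hnd hBs
  have hSA : ∀ {v}, v ∈ S → v ∉ A := fun h1 h2 => Finset.disjoint_left.1 hs.disj h1 h2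
  have hlen : Bs.length ≤ 2 ^ S.card := by
    rw [← List.toFinset_card_of_nodup hnd, ← Finset.card_powerset]
    refine Finset.card_le_card fun B hB => ?_
    rw [List.mem_toFinset, hBs] at hB
    exact Finset.mem_powerset.2 hB
  choose Hf hHlen hHmem hHev using fun B : Finset (Fin n) => h₃ le_rfl G A (B ∪ A)
  have hchild : ∀ B, ∃ L : List (Finset (Fin n)), B ⊆ S → IsConnectedDominatingSet G (B ∪ A) →
      L.Nodup ∧ (∀ D ∈ L, IsMinimalConnectedDominatingSet G D ∧ B ⊆ D ∧ D ⊆ B ∪ A) ∧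
      (∀ T, IsMinimalTransversal (Hf B) T → IsMinimalConnectedDominatingSet G (B ∪ T) →
        B ∪ T ∈ L) ∧
      ∀ acc : List (Finset (Fin n)),
        Ev prog [.cons (ofVertexSet B) (.cons (ofFamily (Hf B))
          (.cons (graphData G) (ofFamily acc)))]
          enumBody (ofFamily (L ++ acc)) (branchBound (q (n * n + n + 1)) A.card) := by
    intro B
    by_cases h : B ⊆ S ∧ IsConnectedDominatingSet G (B ∪ A)
    · obtain ⟨hB, hc⟩ := h
      obtain ⟨L, hL⟩ := h₄ (N := n * n + n + 1) (by nlinarith) G hnest A.card A B (Hf B) rfl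
        ((hHlen B).trans (by omega))
        (by
          intro f hf
          obtain ⟨hnc, rfl | ⟨x, y, rfl⟩⟩ := (hHmem B f).1 hf
          · exact ⟨f, Or.inl rfl, (Finset.inter_self f).symm⟩
          · refine ⟨commonNbrs G x y, Or.inr ⟨x, ?_, y, ?_, rfl⟩, ?_⟩
            -- For x ∈ A the neighbours of x lie in S, so the hyperedge would be empty, and deleting
            -- it leaves B ∪ A, which is connected dominating.
            · by_contra hx
              have hxA := (hs.cover x).resolve_left hx
              refine hnc (hc.mono fun v hv => Finset.mem_sdiff.2 ⟨hv, fun hvf => ?_⟩)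
              simp only [Finset.mem_inter, mem_commonNbrs, and_self] at hvf
              exact hSA (hs.adj_right hvf.2.1 hxA) hvf.1
            · by_contra hy
              have hyA := (hs.cover y).resolve_left hy
              refine hnc (hc.mono fun v hv => Finset.mem_sdiff.2 ⟨hv, fun hvf => ?_⟩)
              simp only [Finset.mem_inter, mem_commonNbrs, and_self] at hvf
              exact hSA (hs.adj_right hvf.2.2 hyA) hvf.1
            · ext v
              simp only [Finset.mem_inter, mem_commonNbrs, and_self]
              exact and_comm)
        (hs.disj.mono_left hB)
      exact ⟨L, fun _ _ => hL⟩
    · exact ⟨[], fun h1 h2 => absurd ⟨h1, h2⟩ h⟩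
  choose Lc hLc using hchild
  let F : Finset (Fin n) → List (Finset (Fin n)) := fun B =>
    if IsConnectedDominatingSet G (B ∪ A) then Lc B else []
  have hF : ∀ B D, D ∈ F B → IsConnectedDominatingSet G (B ∪ A) ∧ D ∈ Lc B := by
    intro B D hD
    dsimp only [F] at hD
    split_ifs at hD with hv
    · exact ⟨hv, hD⟩
    · simp at hD
  have hDB : ∀ B ∈ Bs, ∀ D ∈ F B, D ∩ S = B := by
    intro B hB D hD
    obtain ⟨hc, hD⟩ := hF B D hD
    obtain ⟨_, h1, h2⟩ := (hLc B ((hBs B).1 hB) hc).2.1 D hD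
    ext v
    rw [Finset.mem_inter]
    refine ⟨fun hv => ?_, fun hv => ⟨h1 hv, (hBs B).1 hB hv⟩⟩
    exact (Finset.mem_union.1 (h2 hv.1)).resolve_right (hSA hv.2)
  refine ⟨Bs.flatMap F, ?_, fun D => ⟨fun hD => ?_, fun hD => ?_⟩, ?_⟩
  · rw [List.nodup_flatMap]
    constructor
    · intro B hB
      dsimp only [F]
      split_ifs with hc
      · exact (hLc B ((hBs B).1 hB) hc).1
      · exact List.nodup_nil
    · refine List.Pairwise.imp_of_mem (fun {B B'} hB hB' hne => ?_) hnd
      intro D hD hD'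
      exact hne ((hDB B hB D hD).symm.trans (hDB B' hB' D hD'))
  · obtain ⟨B, hB, hDB'⟩ := List.mem_flatMap.1 hD
    obtain ⟨hc, hDL⟩ := hF B D hDB'
    exact ((hLc B ((hBs B).1 hB) hc).2.1 D hDL).1
  · have hDe : D ∩ S ∪ D ∩ A = D := by
      ext v
      have := hs.cover v
      simp only [Finset.mem_union, Finset.mem_inter]
      tauto
    have hc : IsConnectedDominatingSet G (D ∩ S ∪ A) := hD.prop.mono (by
      conv_lhs => rw [← hDe]
      exact Finset.union_subset_union_right Finset.inter_subset_right)
    refine List.mem_flatMap.2 ⟨D ∩ S, (hBs _).2 Finset.inter_subset_right, ?_⟩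
    have := (hLc (D ∩ S) Finset.inter_subset_right hc).2.2.1 (D ∩ A)
      (isMinimalTransversal_of_isMinimal hs hrich hD (hHmem (D ∩ S))) (hDe.symm ▸ hD)
    rw [hDe] at this
    dsimp only [F]
    rwa [if_pos hc]
  · rw [← List.append_nil (Bs.flatMap F), ← foldr_append_eq]
    refine (Ev.foldr rfl ofVertexSet ofFamily (fun B r => F B ++ r) (b₀ := []) (Ev.of_isPure)
      Bs hlen (K₁ := K₁ n + K₂ n + K₃ n + 150 + branchBound (q (n * n + n + 1)) A.card)
      fun B hB L l => (Ev.bind (Ev.call rfl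
        (Ev.of_isPure (d := .cons (ofVertexSet B) (ofVertexSet A))) (h₂ le_rfl B A))
        (Ev.ite (Ev.call rfl (Ev.of_isPure (d := .cons (unitsData n)
            (.cons (ofVertexSet (B ∪ A)) (graphData G)))) (h₁ le_rfl G (B ∪ A)))
          (fun hc => (Ev.call rfl (Ev.cons (Ev.of_isPure (d := ofVertexSet B))
            (Ev.cons (Ev.call rfl (Ev.of_isPure (d := .cons (rowsData G) (.cons (ofVertexSet A)
              (.cons (ofVertexSet (B ∪ A)) (graphData G))))) (hHev B))
              (Ev.of_isPure (d := .cons (graphData G) (ofFamily L)))))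
              ((hLc B ((hBs B).1 hB) hc).2.2.2 L)).of_eq (by dsimp only [F]; rw [if_pos hc]))
          (fun hc => (Ev.of_isPure (d := ofFamily L)).of_eq
            (by dsimp only [F]; rw [if_neg hc]; rfl)))).mono ?_).mono ?_
    · simp only [Term.cost]
      omega
    · have : 1 ≤ 2 ^ S.card := Nat.one_le_two_pow
      simp only [Term.cost]
      nlinarith

theorem rowsData_eq {n : ℕ} (G : SimpleGraph (Fin n)) :
    ofList (List.ofFn fun v : Fin n => ofList (List.ofFn fun w : Fin n => ofProp (G.Adj v w))) =
      rowsData G := by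
  simp [rowsData, List.ofFn_eq_map, ofVertexSet]

/-- The worst case is s = a, where the base is the square root of 2 · 1.45 = 2.9 ≤ 1.703²; each
further vertex of A costs only 1.45 ≤ 1.703. -/
theorem two_pow_mul_pow_le {s a : ℕ} (h : s ≤ a) :
    (2 : ℝ) ^ s * 1.45 ^ a ≤ 1.703 ^ (s + a) := by
  obtain ⟨d, rfl⟩ := Nat.exists_eq_add_of_le h
  calc (2 : ℝ) ^ s * 1.45 ^ (s + d) = (2 * 1.45) ^ s * 1.45 ^ d := by
        rw [mul_pow, pow_add]; ring
    _ ≤ (1.703 ^ 2) ^ s * 1.703 ^ d := by gcongr <;> norm_num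
    _ = 1.703 ^ (s + (s + d)) := by rw [← pow_mul, ← pow_add]; congr 1; ring

theorem exists_cost_le {K q : ℕ → ℕ} (hK : Poly K) (hq : Poly q) :
    ∃ C : ℝ, ∀ s a : ℕ, s ≤ a →
      ((2 ^ s * (K (s + a) + branchBound (q (s + a)) a) : ℕ) : ℝ) ≤ C * 1.7254 ^ (s + a) := by
  have hp : Poly fun n => K n + q n * (n + 1) := by fun_prop
  -- All polynomial factors are paid for by the ratio of the claimed base to 1.703.
  obtain ⟨C, hC⟩ := hp.exists_le (r := 1.7254 / 1.703) (by norm_num)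
  refine ⟨C, fun s a h => ?_⟩
  have h1 : (1 : ℝ) ≤ 1.45 ^ a := one_le_pow₀ (by norm_num)
  have hf : (branchBound (q (s + a)) a : ℝ) ≤ q (s + a) * (a + 1) * 1.45 ^ a :=
    Nat.floor_le (by positivity)
  have h2 := hC (s + a)
  push_cast at h2 ⊢
  have hs : (0 : ℝ) ≤ s := Nat.cast_nonneg s
  have hCp : 0 ≤ C * (1.7254 / 1.703 : ℝ) ^ (s + a) := le_trans (by positivity) h2
  calc (2 : ℝ) ^ s * (K (s + a) + branchBound (q (s + a)) a)
      ≤ 2 ^ s * (K (s + a) * 1.45 ^ a + q (s + a) * (s + a + 1) * 1.45 ^ a) := by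
        gcongr
        · exact le_mul_of_one_le_right (Nat.cast_nonneg _) h1
        · refine hf.trans ?_
          gcongr
          linarith
    _ = (K (s + a) + q (s + a) * (s + a + 1)) * (2 ^ s * 1.45 ^ a) := by ring
    _ ≤ (C * (1.7254 / 1.703) ^ (s + a)) * 1.703 ^ (s + a) :=
        mul_le_mul h2 (two_pow_mul_pow_le h) (by positivity) hCp
    _ = C * 1.7254 ^ (s + a) := by rw [mul_assoc, ← mul_pow]; norm_num

theorem exists_enumeration : ∃ C : ℝ, ∀ (n : ℕ) (G : SimpleGraph (Fin n)) (U W : Finset (Fin n))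
    (pos : Fin n → ℕ), Sides G U W → ConvexOrder G W pos →
    ∃ (L : List (Finset (Fin n))) (k : ℕ), L.Nodup ∧
      (∀ D, D ∈ L ↔ IsMinimalConnectedDominatingSet G D) ∧
      prog.Outputs (Data.ofGraph G U) (ofFamily L) k ∧ (k : ℝ) ≤ C * 1.7254 ^ n := by
  obtain ⟨K₁, hK₁, h₁⟩ := ev_compl
  obtain ⟨K₂, hK₂, h₂⟩ := ev_units
  obtain ⟨K₃, hK₃, h₃⟩ := ev_union
  obtain ⟨K₄, hK₄, h₄⟩ := ev_trues
  obtain ⟨K₅, hK₅, h₅⟩ := ev_le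
  obtain ⟨K₆, hK₆, h₆⟩ := ev_subsets
  obtain ⟨K₇, q, hK₇, hq, h₇⟩ := ev_collect
  obtain ⟨C, hC⟩ := exists_cost_le
    (K := fun n => K₁ n + K₂ n + K₃ n + 2 * K₄ n + K₅ n + K₆ n + K₇ n + 200) (by fun_prop) hq
  refine ⟨C, fun n G U W pos hs hp => ?_⟩
  have hW : Uᶜ = W := by
    ext v
    rw [Finset.mem_compl]
    exact ⟨(hs.cover v).resolve_left, fun h1 h2 => Finset.disjoint_left.1 hs.disj h2 h1⟩
  have hUW : U ∪ W = Finset.univ := Finset.eq_univ_of_forall fun v => by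
    simpa using hs.cover v
  have hcard : U.card + W.card = n := by
    rw [← Finset.card_union_of_disjoint hs.disj, hUW]
    simp
  have hUn : U.card ≤ n := by omega
  have hcompl : Ev prog [.cons (ofVertexSet U) .nil] complBody (ofVertexSet W) (K₁ n) :=
    hW ▸ h₁ le_rfl U
  have hunits : Ev prog [.cons (ofVertexSet U) .nil] unitsBody (unitsData n) (K₂ n) := by
    have := h₂ (N := n) (List.ofFn fun v : Fin n => ofProp (v ∈ U)) (by simp)
    rwa [List.length_ofFn] at this
  have hall : Ev prog [.cons (ofVertexSet U) (ofVertexSet W)] unionBody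
      (ofVertexSet (Finset.univ : Finset (Fin n))) (K₃ n) := hUW ▸ h₃ le_rfl U W
  have hin : Data.ofGraph G U = .cons (ofVertexSet U) (rowsData G) := by
    rw [Data.ofGraph, rowsData_eq]
  -- One statement serves both outcomes of the size comparison; the branch not taken is vacuous and
  -- is later given cost 0.
  have hmain : ∀ {L : List (Finset (Fin n))} {k l : ℕ},
      (U.card ≤ W.card → Ev prog [graphData G, ofVertexSet W, Data.ofGraph G U]
        (.call collectFn (.cons (.call subsetsFn (.cons (.head (.var 2)) .nil))
          (.cons (.var 1) (.var 0)))) (ofFamily L) k) →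
      (¬ U.card ≤ W.card → Ev prog [graphData G, ofVertexSet W, Data.ofGraph G U]
        (.call collectFn (.cons (.call subsetsFn (.cons (.var 1) .nil))
          (.cons (.head (.var 2)) (.var 0)))) (ofFamily L) l) →
      Ev prog [Data.ofGraph G U] (.call 0 (.var 0)) (ofFamily L)
        (K₁ n + K₂ n + K₃ n + 2 * K₄ n + K₅ n + 100 + (k + l)) := by
    intro L k l hyes hno
    rw [hin] at hyes hno ⊢
    refine (Ev.call rfl (Ev.of_isPure (d := .cons (ofVertexSet U) (rowsData G)))
      (Ev.bind (Ev.call rfl (Ev.of_isPure (d := .cons (ofVertexSet U) .nil)) hcompl)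
        (Ev.bind (b := ofFamily L) (a := graphData G) (Ev.cons
          (Ev.call rfl (Ev.of_isPure (d := .cons (ofVertexSet U) .nil)) hunits)
          (Ev.cons (Ev.of_isPure (d := rowsData G)) (Ev.call rfl
            (Ev.of_isPure (d := .cons (ofVertexSet U) (ofVertexSet W))) hall)))
          (Ev.ite (Ev.call rfl (Ev.cons
            (Ev.call rfl (Ev.of_isPure (d := .cons (ofVertexSet U) .nil)) (h₄ le_rfl U))
            (Ev.call rfl (Ev.of_isPure (d := .cons (ofVertexSet W) .nil)) (h₄ le_rfl W)))
            (h₅ hUn)) hyes hno)))).mono ?_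
    simp only [Term.cost]
    omega
  have hcost : ∀ {S A : Finset (Fin n)} {k : ℕ}, S.card + A.card = n → S.card ≤ A.card →
      k ≤ K₁ n + K₂ n + K₃ n + 2 * K₄ n + K₅ n + 150 + (2 ^ S.card * K₆ n +
        2 ^ S.card * (K₇ n + branchBound (q n) A.card)) → (k : ℝ) ≤ C * 1.7254 ^ n := by
    intro S A k hSA hle hk
    have h := hC S.card A.card hle
    rw [hSA] at h
    refine le_trans ?_ h
    have h1 : 1 ≤ 2 ^ S.card := Nat.one_le_two_pow
    exact_mod_cast (by nlinarith : k ≤ 2 ^ S.card * (K₁ n + K₂ n + K₃ n + 2 * K₄ n + K₅ n + K₆ n +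
      K₇ n + 200 + branchBound (q n) A.card))
  -- The subsets of the smaller class are enumerated and the transversals live on the larger one.
  rcases le_or_gt U.card W.card with hle | hlt
  · obtain ⟨Bs, hnd, hBs, hev⟩ := h₆ le_rfl U
    obtain ⟨L, hL, hmem, hevL⟩ :=
      h₇ G hs (hasNested_right hs hp) (rich_right hs hp) Bs hnd hBs
    obtain ⟨k, hk, hout⟩ := hmain (l := 0)
      (fun _ => Ev.call rfl (Ev.cons
        (Ev.call rfl (Ev.of_isPure (d := .cons (ofVertexSet U) .nil)) hev)
        (Ev.of_isPure (d := .cons (ofVertexSet W) (graphData G)))) hevL)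
      (fun h => absurd hle h)
    refine ⟨L, k, hL, hmem, hout, hcost hcard hle (hk.trans ?_)⟩
    simp only [Term.cost]
    omega
  · obtain ⟨Bs, hnd, hBs, hev⟩ := h₆ le_rfl W
    obtain ⟨L, hL, hmem, hevL⟩ :=
      h₇ G hs.symm (hasNested_left hs hp) (rich_left hs hp) Bs hnd hBs
    obtain ⟨k, hk, hout⟩ := hmain (k := 0) (fun h => absurd hlt (not_lt.2 h))
      (fun _ => Ev.call rfl (Ev.cons
        (Ev.call rfl (Ev.of_isPure (d := .cons (ofVertexSet W) .nil)) hev)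
        (Ev.cons (Ev.of_isPure (d := ofVertexSet U)) (Ev.of_isPure (d := graphData G)))) hevL)
    refine ⟨L, k, hL, hmem, hout, hcost (by omega) hlt.le (hk.trans ?_)⟩
    simp only [Term.cost]
    omega

end Lisp

/-! ### Isomorphic copies -/

section Transport

variable {V V' : Type*} {G : SimpleGraph V} {G' : SimpleGraph V'} (φ : G ≃g G')

theorem IsConnectedDominatingSet.map {D : Finset V} (h : IsConnectedDominatingSet G D) :
    IsConnectedDominatingSet G' (D.map φ.toEquiv.toEmbedding) := by
  obtain ⟨v, hv, hr⟩ := isConnectedDominatingSet_iff.1 h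
  refine isConnectedDominatingSet_of_reachThrough (v := φ v) (Finset.mem_map_of_mem _ hv) fun w => ?_
  have h1 : ReachThrough G' (D.map φ.toEquiv.toEmbedding) (φ v) (φ (φ.symm w)) :=
    Relation.ReflTransGen.lift φ
      (fun a b hab => ⟨Finset.mem_map_of_mem _ hab.1, φ.map_adj_iff.2 hab.2⟩) _ _ (hr (φ.symm w))
  simpa using h1

theorem isConnectedDominatingSet_map_iff {D : Finset V} :
    IsConnectedDominatingSet G' (D.map φ.toEquiv.toEmbedding) ↔
      IsConnectedDominatingSet G D := by
  refine ⟨fun h => ?_, fun h => h.map φ⟩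
  have := h.map φ.symm
  rw [Finset.map_map] at this
  convert this
  ext v
  simp

theorem IsMinimalConnectedDominatingSet.map {D : Finset V}
    (h : IsMinimalConnectedDominatingSet G D) :
    IsMinimalConnectedDominatingSet G' (D.map φ.toEquiv.toEmbedding) := by
  classical
  rw [isMinimalConnectedDominatingSet_iff] at h ⊢
  refine ⟨h.1.map φ, fun v hv => ?_⟩
  obtain ⟨u, hu, rfl⟩ := Finset.mem_map.1 hv
  rw [← Finset.map_erase, isConnectedDominatingSet_map_iff]
  exact h.2 u hu

theorem Sides.map {S A : Finset V} (h : Sides G S A) :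
    Sides G' (S.map φ.toEquiv.toEmbedding) (A.map φ.toEquiv.toEmbedding) where
  cover v := by
    rw [Finset.mem_map_equiv, Finset.mem_map_equiv]
    exact h.cover (φ.symm v)
  disj := (Finset.disjoint_map _).2 h.disj
  adj_left {x y} hxy hx := by
    rw [Finset.mem_map_equiv] at *
    exact h.adj_left (φ.symm.map_adj_iff.2 hxy) hx
  adj_right {x y} hxy hx := by
    rw [Finset.mem_map_equiv] at *
    exact h.adj_right (φ.symm.map_adj_iff.2 hxy) hx

theorem ConvexOrder.map {W : Finset V} {pos : V → ℕ} (h : ConvexOrder G W pos) :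
    ConvexOrder G' (W.map φ.toEquiv.toEmbedding) (pos ∘ φ.symm) where
  inj a ha b hb hab := by
    rw [Finset.mem_coe, Finset.mem_map_equiv] at ha hb
    exact φ.symm.injective (h.inj ha hb hab)
  conv {u a b c} hua huc ha hb hc hab hbc := by
    rw [Finset.mem_map_equiv] at ha hb hc
    exact φ.symm.map_adj_iff.1 (h.conv (φ.symm.map_adj_iff.2 hua) (φ.symm.map_adj_iff.2 huc)
      ha hb hc hab hbc)

end Transport

/-! ### The theorem -/

theorem mainTheorem1 :
    (∃ C : ℝ, ∀ (V : Type*) [Fintype V] (G : SimpleGraph V) (U W : Finset V),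
      IsConvexBipartite G U W →
        ({D : Finset V | IsMinimalConnectedDominatingSet G D}.ncard : ℝ)
          ≤ C * (1.7254 : ℝ) ^ Fintype.card V) ∧
    (∃ (P : Lisp.Program) (C : ℝ), ∀ (n : ℕ) (G : SimpleGraph (Fin n)) (U W : Finset (Fin n)),
      IsConvexBipartite G U W →
        ∃ (L : List (Finset (Fin n))) (k : ℕ),
          L.Nodup ∧ (∀ D : Finset (Fin n), D ∈ L ↔ IsMinimalConnectedDominatingSet G D) ∧
          P.Outputs (Lisp.Data.ofGraph G U) (Lisp.Data.ofFamily L) k ∧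
          (k : ℝ) ≤ C * (1.7254 : ℝ) ^ n) := by
  obtain ⟨C, hC⟩ := Lisp.exists_enumeration
  refine ⟨?_, Lisp.prog, C, fun n G U W h => ?_⟩
  -- The number of sets is bounded through a run of the algorithm on a copy of G on {0, …, n - 1};
  -- the height 2n + 2 of the input goes into C'.
  · obtain ⟨C', hC'⟩ := Lisp.Poly.exists_le (K := fun n => 2 * n + 2) (r := 1.7254)
      (by fun_prop) (by norm_num)
    refine ⟨C + C', fun V _ G U W h => ?_⟩
    obtain ⟨pos, hpos⟩ := h.exists_convexOrder
    let φ : G ≃g G.map (Fintype.equivFin V).toEmbedding := SimpleGraph.Iso.map (Fintype.equivFin V) G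
    obtain ⟨L, k, -, hmem, hout, hk⟩ :=
      hC _ _ _ _ _ (h.sides.map φ) (hpos.map φ)
    have hlen : L.length ≤ 2 * Fintype.card V + 2 + k := by
      have h1 := hout.height_le (2 * Fintype.card V + 2) (by
        simp only [List.mem_singleton, forall_eq]
        exact Lisp.Data.height_ofGraph_le _ _)
      have h2 := Lisp.Data.length_le_height (L.map Lisp.Data.ofVertexSet)
      rw [List.length_map] at h2
      exact h2.trans h1
    -- The isomorphism maps the minimal connected dominating sets of G injectively into the output
    -- list.
    have hcard : {D : Finset V | IsMinimalConnectedDominatingSet G D}.ncard ≤ L.length := by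
      rw [← Set.ncard_image_of_injective _
        (Finset.map_injective φ.toEquiv.toEmbedding)]
      refine le_trans (Set.ncard_le_ncard (t := (L.toFinset : Set _)) ?_
        (Finset.finite_toSet _)) ?_
      · rintro _ ⟨D, hD, rfl⟩
        simpa using (hmem _).2 (hD.map φ)
      · rw [Set.ncard_coe_finset]
        exact L.toFinset_card_le
    have h3 : (({D : Finset V | IsMinimalConnectedDominatingSet G D}.ncard : ℕ) : ℝ) ≤
        ((2 * Fintype.card V + 2 : ℕ) : ℝ) + k := by exact_mod_cast hcard.trans hlen
    have h4 := hC' (Fintype.card V)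
    linarith
  · obtain ⟨pos, hpos⟩ := h.exists_convexOrder
    exact hC n G U W pos h.sides hpos
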